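/- A lattice is *l.f.f.c.* if all its intervals $[a,b]$ are finite and every element has finitely many upper covers and finitely many lower covers. A *tolerance* on a lattice is a reflexive symmetric relation $\gamma$ such that $a\,\gamma\, b$ and $c\,\gamma\, d$ imply $a\vee c\;\gamma\; b\vee d$ and $a\wedge c\;\gamma\; b\wedge d$; write $x\le_\gamma y$ if $x\le y$ and $x\,\gamma\,y$. Filters and ideals are nonempty lattice filters and ideals. **M.c. systems.** A *modular connected system* (m.c. system) consists of a lattice $S$ (the skeleton), a tolerance $\gamma$ on $S$, lattices $(L_x)_{x\in S}$ (the blocks), and maps $(\phi_x^y)_{x\le_\gamma y}$ (the connections), such that: 1. $S$ is l.f.f.c. 2. Each $L_x$ is a finite, modular, complemented (in particular bounded) lattice. 3. Each $\phi_x^y$ is a lattice isomorphism from a filter $F_x^y$ of $L_x$ onto an ideal $I_x^y$ of $L_y$. 4. $F_x^x=I_x^x=L_x$ and $\phi_x^x$ is the identity. 5. If $x\le_\gamma y\le_\gamma z$ and $I_x^y\cap F_y^z\ne\emptyset$, then $x\,\gamma\,z$. 6. If $x\le z\le y$ and $x\,\gamma\,y$, then $F_x^y=(\phi_x^z)^{-1}(I_x^z\cap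 F_z^y)$, $I_x^y=\phi_z^y(I_x^z\cap F_z^y)$, and $\phi_x^y=\phi_z^y\circ\phi_x^z|_{F_x^y}$. 7. If $x\,\gamma\,y$, then $I_x^{x\vee y}\cap I_y^{x\vee y}\subseteq I_{x\wedge y}^{x\vee y}$ and $F_{x\wedge y}^x\cap F_{x\wedge y}^y\subseteq F_{x\wedge y}^{x\vee y}$. 8. If $y$ covers $x$ in $S$, then $x\,\gamma\,y$, $F_x^y\neq L_x$ and $I_x^y\ne L_y$. An *isomorphism* from such a system to another one $(S',\gamma',L',\phi')$ consists of a lattice isomorphism $\chi:S\to S'$ and lattice isomorphisms $\chi_x:L_x\to L'_{\chi(x)}$ ($x\in S$) such that $x\,\gamma\,y\iff\chi(x)\,\gamma'\,\chi(y)$ and, for $x\le_\gamma y$, $\chi_x(F_x^y)=F'^{\,\chi(y)}_{\chi(x)}$, $\chi_y(I_x^y)=I'^{\,\chi(y)}_{\chi(x)}$, and $\chi_y(\phi_x^y(a))=\phi'^{\,\chi(y)}_{\chi(x)}(\chi_x(a))$ for all $a\in F_x^y$. **Gluing.** Let $M=\{(x,a): x\in S,\ a\in L_x\}$, and let $(x,a)\sim(y,b)$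 mean that $x\,\gamma\,y$, $a\in F_x^{x\vee y}$, $b\in F_y^{x\vee y}$ and $\phi_x^{x\vee y}(a)=\phi_y^{x\vee y}(b)$. The *sum* of the system is $M/{\sim}$, with canonical maps $\pi_x:L_x\to M/{\sim}$, $a\mapsto[(x,a)]$. Write $p\le_x q$ if $p=\pi_x(a)$ and $q=\pi_x(b)$ for some $a\le b$ in $L_x$. The order of the sum is: $p\le q$ iff there are $n\ge0$, $x_1\le\dots\le x_n$ in $S$ and $p=c_0,c_1,\dots,c_n=q$ in the sum with $c_{i-1}\le_{x_i}c_i$ for $1\le i\le n$. **Dissection.** A *block* of a modular l.f.f.c. lattice $L$ is an inclusion-maximal complemented interval $B=[0_B,1_B]$ of $L$. The *dissection* of $L$ has as skeleton the set of blocks, ordered by $B\le C\iff 0_B\le 0_C$; as overlap relation $B\,\gamma\, C\iff B\cap C\neq\emptyset$; as block at $B$ the lattice $B$ itself; and, for $B\le_\gamma C$, $F_B^C=I_B^C=B\cap C$ with $\phi_B^C$ the identity map. **Theorem.** For every m.c. system, $\sim$ is an equivalence relation and the sum, with its order, is a modular l.f.f.c. lattice. For every modular l.f.f.c. lattice, the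 skeleton of its dissection is a lattice and the dissection is an m.c. system. Isomorphic m.c. systems have isomorphic sums, and isomorphic modular l.f.f.c. lattices have isomorphic dissections. The induced maps between the isomorphism classes of m.c. systems and the isomorphism classes of modular l.f.f.c. lattices are mutually inverse; thus both are bijective. Moreover, the skeleton of an m.c. system has a minimum element iff its sum has one, and the skeleton of the dissection of a modular l.f.f.c. lattice has a minimum element iff the lattice has one. -/

import Mathlib

universe u

namespace LatticeGluing

/-- A lattice is l.f.f.c. (locally finite with finite covers). -/
structure IsLFFC (α : Type u) [Lattice α] : Prop where
  finite_interval : ∀ a b : α, (Set.Icc a b).Finite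
  finite_upper_covers : ∀ a : α, {b : α | a ⋖ b}.Finite
  finite_lower_covers : ∀ a : α, {b : α | b ⋖ a}.Finite

/-- A lattice which has a least and a greatest element and in which every element has a
complement. -/
def IsComplementedLattice (α : Type u) [Lattice α] : Prop :=
  ∃ _ : BoundedOrder α, ComplementedLattice α

/-- A tolerance on a lattice. -/
structure IsTolerance {S : Type u} [Lattice S] (r : S → S → Prop) : Prop where
  refl : ∀ a, r a a
  symm : ∀ a b, r a b → r b a
  sup : ∀ a b c d, r a b → r c d → r (a ⊔ c) (b ⊔ d)
  inf : ∀ a b c d, r a b → r c d → r (a ⊓ c) (b ⊓ d)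

/-- The relation `x ≤_γ y`: both `x ≤ y` and `x γ y`. -/
def LeTol {S : Type u} [LE S] (r : S → S → Prop) (x y : S) : Prop :=
  x ≤ y ∧ r x y

/-- The data of a connected system over the skeleton `S`: an overlap relation `tol`, the blocks,
and, for `x ≤_γ y`, an isomorphism `conn x y` from the ordered subset `source x y` of the block
at `x` onto the ordered subset `target x y` of the block at `y`. -/
structure ConnectionData (S : Type u) [Lattice S] where
  tol : S → S → Prop
  block : S → Type u
  blockLattice : ∀ x, Lattice (block x)
  source : ∀ x y, LeTol tol x y → Set (block x)
  target : ∀ x y, LeTol tol x y → Set (block y)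
  conn : ∀ x y (h : LeTol tol x y), source x y h ≃o target x y h

attribute [instance] ConnectionData.blockLattice

/-- The axioms of a modular connected system. In the `_trans` and `inter_` axioms
the hypotheses `LeTol` on the intermediate pairs only name the connections involved: they follow
from the tolerance property, see `LeTol.of_between` and `LeTol.of_tol` below. -/
structure IsModularConnected {S : Type u} [Lattice S] (D : ConnectionData S) : Prop where
  tolerance : IsTolerance D.tol
  skeleton_lffc : IsLFFC S
  block_finite : ∀ x, Finite (D.block x)
  block_modular : ∀ x, IsModularLattice (D.block x)
  block_complemented : ∀ x, IsComplementedLattice (D.block x)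
  source_filter : ∀ x y h, Order.IsPFilter (D.source x y h)
  target_ideal : ∀ x y h, Order.IsIdeal (D.target x y h)
  source_self : ∀ x h, D.source x x h = Set.univ
  target_self : ∀ x h, D.target x x h = Set.univ
  conn_self : ∀ x h (a : D.source x x h), (D.conn x x h a : D.block x) = a
  tol_of_overlap : ∀ x y z (hxy : LeTol D.tol x y) (hyz : LeTol D.tol y z),
    (D.target x y hxy ∩ D.source y z hyz).Nonempty → D.tol x z
  source_trans : ∀ x z y (hxz : LeTol D.tol x z) (hzy : LeTol D.tol z y) (hxy : LeTol D.tol x y),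
    D.source x y hxy = {a | ∃ ha : a ∈ D.source x z hxz,
      (D.conn x z hxz ⟨a, ha⟩ : D.block z) ∈ D.target x z hxz ∩ D.source z y hzy}
  target_trans : ∀ x z y (hxz : LeTol D.tol x z) (hzy : LeTol D.tol z y) (hxy : LeTol D.tol x y),
    D.target x y hxy = {b | ∃ (c : D.block z) (hc : c ∈ D.source z y hzy),
      c ∈ D.target x z hxz ∧ (D.conn z y hzy ⟨c, hc⟩ : D.block y) = b}
  conn_trans : ∀ x z y (hxz : LeTol D.tol x z) (hzy : LeTol D.tol z y) (hxy : LeTol D.tol x y)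
    (a : D.block x) (ha : a ∈ D.source x y hxy) (ha' : a ∈ D.source x z hxz)
    (hc : (D.conn x z hxz ⟨a, ha'⟩ : D.block z) ∈ D.source z y hzy),
    (D.conn x y hxy ⟨a, ha⟩ : D.block y) = D.conn z y hzy ⟨D.conn x z hxz ⟨a, ha'⟩, hc⟩
  inter_target : ∀ x y, D.tol x y →
    ∀ (hx : LeTol D.tol x (x ⊔ y)) (hy : LeTol D.tol y (x ⊔ y))
      (h : LeTol D.tol (x ⊓ y) (x ⊔ y)),
    D.target x (x ⊔ y) hx ∩ D.target y (x ⊔ y) hy ⊆ D.target (x ⊓ y) (x ⊔ y) h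
  inter_source : ∀ x y, D.tol x y →
    ∀ (hx : LeTol D.tol (x ⊓ y) x) (hy : LeTol D.tol (x ⊓ y) y)
      (h : LeTol D.tol (x ⊓ y) (x ⊔ y)),
    D.source (x ⊓ y) x hx ∩ D.source (x ⊓ y) y hy ⊆ D.source (x ⊓ y) (x ⊔ y) h
  tol_of_covBy : ∀ x y, x ⋖ y → D.tol x y
  source_ne : ∀ x y h, x ⋖ y → D.source x y h ≠ Set.univ
  target_ne : ∀ x y h, x ⋖ y → D.target x y h ≠ Set.univ

theorem LeTol.of_between {S : Type u} [Lattice S] {r : S → S → Prop} (hr : IsTolerance r)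
    {x z y : S} (hxz : x ≤ z) (hzy : z ≤ y) (hxy : r x y) : LeTol r x z ∧ LeTol r z y := by
  have h1 := hr.inf x y z z hxy (hr.refl z)
  have h2 := hr.sup x y z z hxy (hr.refl z)
  rw [inf_eq_left.2 hxz, inf_eq_right.2 hzy] at h1
  rw [sup_eq_right.2 hxz, sup_eq_left.2 hzy] at h2
  exact ⟨⟨hxz, h1⟩, ⟨hzy, hr.symm _ _ (hr.symm _ _ h2)⟩⟩

theorem LeTol.of_tol {S : Type u} [Lattice S] {r : S → S → Prop} (hr : IsTolerance r)
    {x y : S} (h : r x y) :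
    LeTol r x (x ⊔ y) ∧ LeTol r y (x ⊔ y) ∧ LeTol r (x ⊓ y) x ∧ LeTol r (x ⊓ y) y ∧
      LeTol r (x ⊓ y) (x ⊔ y) := by
  have h' := hr.symm _ _ h
  have a1 : r x (x ⊔ y) := by simpa using hr.sup x x x y (hr.refl x) h
  have a2 : r y (x ⊔ y) := by simpa using hr.sup y x y y h' (hr.refl y)
  have a3 : r (x ⊓ y) x := by simpa using hr.inf x x y x (hr.refl x) h'
  have a4 : r (x ⊓ y) y := by simpa using hr.inf x y y y h (hr.refl y)
  have a5 : r (x ⊓ y) (x ⊔ y) := by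
    have e := hr.sup _ _ _ _ a3 a4
    rwa [sup_idem] at e
  exact ⟨⟨le_sup_left, a1⟩, ⟨le_sup_right, a2⟩, ⟨inf_le_left, a3⟩, ⟨inf_le_right, a4⟩,
    ⟨inf_le_left.trans le_sup_left, a5⟩⟩

/-- A modular connected system (m.c. system). -/
structure MCSystem where
  skeleton : Type u
  skeletonLattice : Lattice skeleton
  data : ConnectionData skeleton
  isModularConnected : IsModularConnected data

attribute [instance] MCSystem.skeletonLattice

/-- A modular l.f.f.c. lattice. -/
structure ModularLFFCLattice where
  carrier : Type u
  lattice : Lattice carrier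
  modular : IsModularLattice carrier
  lffc : IsLFFC carrier

attribute [instance] ModularLFFCLattice.lattice

instance : CoeSort ModularLFFCLattice.{u} (Type u) := ⟨ModularLFFCLattice.carrier⟩

/-! ### Isomorphism -/

/-- An isomorphism of m.c. systems. -/
structure MCSystem.Iso (C C' : MCSystem.{u}) where
  skel : C.skeleton ≃o C'.skeleton
  block : ∀ x, C.data.block x ≃o C'.data.block (skel x)
  tol_iff : ∀ x y, C.data.tol x y ↔ C'.data.tol (skel x) (skel y)
  source_eq : ∀ x y (h : LeTol C.data.tol x y) (h' : LeTol C'.data.tol (skel x) (skel y)),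
    C'.data.source (skel x) (skel y) h' = block x '' C.data.source x y h
  target_eq : ∀ x y (h : LeTol C.data.tol x y) (h' : LeTol C'.data.tol (skel x) (skel y)),
    C'.data.target (skel x) (skel y) h' = block y '' C.data.target x y h
  conn_eq : ∀ x y (h : LeTol C.data.tol x y) (h' : LeTol C'.data.tol (skel x) (skel y))
    (a : C.data.block x) (ha : a ∈ C.data.source x y h)
    (ha' : block x a ∈ C'.data.source (skel x) (skel y) h'),
    block y (C.data.conn x y h ⟨a, ha⟩) = C'.data.conn (skel x) (skel y) h' ⟨block x a, ha'⟩

def MCSystem.Iso.refl (C : MCSystem.{u}) : C.Iso C where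
  skel := OrderIso.refl _
  block x := OrderIso.refl _
  tol_iff x y := Iff.rfl
  source_eq _ _ _ _ := (Set.image_id _).symm
  target_eq _ _ _ _ := (Set.image_id _).symm
  conn_eq x y h h' a ha ha' := rfl

theorem MCSystem.Iso.leTol {C C' : MCSystem.{u}} (e : C.Iso C') {x y : C.skeleton} :
    LeTol C.data.tol x y ↔ LeTol C'.data.tol (e.skel x) (e.skel y) := by
  unfold LeTol
  rw [e.skel.le_iff_le, e.tol_iff x y]

def MCSystem.Iso.trans {C C' C'' : MCSystem.{u}} (e : C.Iso C') (f : C'.Iso C'') :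
    C.Iso C'' where
  skel := e.skel.trans f.skel
  block x := (e.block x).trans (f.block (e.skel x))
  tol_iff x y := (e.tol_iff x y).trans (f.tol_iff _ _)
  source_eq x y h h' := by
    have h1 := e.leTol.1 h
    have := f.source_eq _ _ h1 h'
    rw [e.source_eq x y h h1, Set.image_image] at this
    exact this
  target_eq x y h h' := by
    have h1 := e.leTol.1 h
    have := f.target_eq _ _ h1 h'
    rw [e.target_eq x y h h1, Set.image_image] at this
    exact this
  conn_eq x y h h' a ha ha' := by
    have h1 := e.leTol.1 h
    have hm : e.block x a ∈ C'.data.source _ _ h1 := by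
      rw [e.source_eq x y h h1]; exact ⟨a, ha, rfl⟩
    have e1 := e.conn_eq x y h h1 a ha hm
    have e2 := f.conn_eq _ _ h1 h' _ hm ha'
    change f.block _ (e.block y _) = _
    rw [e1]
    exact e2

/-- Transport of blocks along an equality of indices. -/
def MCSystem.castBlock (C : MCSystem.{u}) {x y : C.skeleton} (h : x = y) :
    C.data.block x ≃o C.data.block y :=
  h ▸ OrderIso.refl _

def MCSystem.Iso.symm {C C' : MCSystem.{u}} (e : C.Iso C') : C'.Iso C where
  skel := e.skel.symm
  block x := (C'.castBlock (e.skel.apply_symm_apply x).symm).trans (e.block (e.skel.symm x)).symm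
  tol_iff x y := by simp [e.tol_iff]
  source_eq x y h h' := by
    have key : ∀ (x y : C'.skeleton) (z w : C.skeleton) (hx : x = e.skel z) (hy : y = e.skel w)
        (h : LeTol C'.data.tol x y) (h' : LeTol C.data.tol z w),
        C.data.source z w h' =
          (fun a => (e.block z).symm (C'.castBlock hx a)) '' C'.data.source x y h := by
      rintro _ _ z w rfl rfl h h'
      rw [e.source_eq z w h' h, Set.image_image]
      simp [MCSystem.castBlock]
    exact key _ _ _ _ (e.skel.apply_symm_apply x).symm (e.skel.apply_symm_apply y).symm h h'
  target_eq x y h h' := by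
    have key : ∀ (x y : C'.skeleton) (z w : C.skeleton) (hx : x = e.skel z) (hy : y = e.skel w)
        (h : LeTol C'.data.tol x y) (h' : LeTol C.data.tol z w),
        C.data.target z w h' =
          (fun a => (e.block w).symm (C'.castBlock hy a)) '' C'.data.target x y h := by
      rintro _ _ z w rfl rfl h h'
      rw [e.target_eq z w h' h, Set.image_image]
      simp [MCSystem.castBlock]
    exact key _ _ _ _ (e.skel.apply_symm_apply x).symm (e.skel.apply_symm_apply y).symm h h'
  conn_eq x y h h' a ha ha' := by
    have key : ∀ (x y : C'.skeleton) (z w : C.skeleton) (hx : x = e.skel z) (hy : y = e.skel w)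
        (h : LeTol C'.data.tol x y) (h' : LeTol C.data.tol z w)
        (a : C'.data.block x) (ha : a ∈ C'.data.source x y h)
        (ha' : (e.block z).symm (C'.castBlock hx a) ∈ C.data.source z w h'),
        (e.block w).symm (C'.castBlock hy (C'.data.conn x y h ⟨a, ha⟩)) =
          C.data.conn z w h' ⟨(e.block z).symm (C'.castBlock hx a), ha'⟩ := by
      rintro _ _ z w rfl rfl h h' a ha ha'
      rw [OrderIso.symm_apply_eq]
      obtain ⟨b, rfl⟩ := (e.block z).surjective a
      have hb : b ∈ C.data.source z w h' := by simpa [MCSystem.castBlock] using ha'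
      have := e.conn_eq z w h' h b hb ha
      simpa [MCSystem.castBlock] using this.symm
    exact key _ _ _ _ (e.skel.apply_symm_apply x).symm (e.skel.apply_symm_apply y).symm h h' a ha ha'

/-- Two m.c. systems are equivalent if they are isomorphic. -/
instance MCSystem.isoSetoid : Setoid MCSystem.{u} where
  r C C' := Nonempty (C.Iso C')
  iseqv := ⟨fun C => ⟨Iso.refl C⟩, fun ⟨e⟩ => ⟨e.symm⟩, fun ⟨e⟩ ⟨f⟩ => ⟨e.trans f⟩⟩

/-- Two modular l.f.f.c. lattices are equivalent if they are isomorphic. -/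
instance ModularLFFCLattice.isoSetoid : Setoid ModularLFFCLattice.{u} where
  r L L' := Nonempty (L ≃o L')
  iseqv := ⟨fun L => ⟨OrderIso.refl L⟩, fun ⟨e⟩ => ⟨e.symm⟩, fun ⟨e⟩ ⟨f⟩ => ⟨e.trans f⟩⟩

/-! ### Gluing -/

/-- The pairs `(x, a)` with `x` in the skeleton and `a` in the block at `x`. -/
abbrev MCSystem.Pairs (C : MCSystem.{u}) : Type u :=
  Σ x : C.skeleton, C.data.block x

/-- `(x, a) ∼ (y, b)`: `x γ y`, and the connections to `x ⊔ y` are defined at `a`, `b` and send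
them to the same element. -/
def MCSystem.Sim (C : MCSystem.{u}) (p q : C.Pairs) : Prop :=
  C.data.tol p.1 q.1 ∧
    ∃ (hx : LeTol C.data.tol p.1 (p.1 ⊔ q.1)) (hy : LeTol C.data.tol q.1 (p.1 ⊔ q.1))
      (ha : p.2 ∈ C.data.source p.1 (p.1 ⊔ q.1) hx)
      (hb : q.2 ∈ C.data.source q.1 (p.1 ⊔ q.1) hy),
      (C.data.conn p.1 (p.1 ⊔ q.1) hx ⟨p.2, ha⟩ : C.data.block (p.1 ⊔ q.1)) =
        C.data.conn q.1 (p.1 ⊔ q.1) hy ⟨q.2, hb⟩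

/-- The underlying set of the sum: the pairs modulo `∼`. -/
def MCSystem.Sum (C : MCSystem.{u}) : Type u :=
  Quot C.Sim

/-- The canonical map of the block at `x` to the sum. -/
def MCSystem.incl (C : MCSystem.{u}) (x : C.skeleton) (a : C.data.block x) : C.Sum :=
  Quot.mk _ ⟨x, a⟩

/-- `p ≤_x q`: both elements of the sum come from the block at `x`, in this order. -/
def MCSystem.LeAt (C : MCSystem.{u}) (x : C.skeleton) (p q : C.Sum) : Prop :=
  ∃ a b : C.data.block x, C.incl x a = p ∧ C.incl x b = q ∧ a ≤ b

/-- `p ≤ q` in the sum: there is an ascending sequence `p = c 0 ≤_{x 0} c 1 ≤_{x 1} ⋯ c n = q`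
with `x 0 ≤ x 1 ≤ ⋯` in the skeleton. -/
def MCSystem.SumLE (C : MCSystem.{u}) (p q : C.Sum) : Prop :=
  ∃ (n : ℕ) (x : Fin n → C.skeleton) (c : Fin (n + 1) → C.Sum),
    Monotone x ∧ (∀ i : Fin n, C.LeAt (x i) (c i.castSucc) (c i.succ)) ∧
      c 0 = p ∧ c (Fin.last n) = q

/-- A lattice structure on the sum has the order of the sum and is modular and l.f.f.c. -/
structure MCSystem.IsSumLattice (C : MCSystem.{u}) (lat : Lattice C.Sum) : Prop where
  le_iff : ∀ p q : C.Sum, p ≤ q ↔ C.SumLE p q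
  modular : IsModularLattice C.Sum
  lffc : IsLFFC C.Sum

/-- The sum lattice of an m.c. system. -/
def MCSystem.glue (C : MCSystem.{u}) (lat : Lattice C.Sum) (h : C.IsSumLattice lat) :
    ModularLFFCLattice.{u} :=
  ⟨C.Sum, lat, h.modular, h.lffc⟩

/-! ### Dissection -/

/-- A block of a lattice: an inclusion-maximal complemented interval `[bot, top]`. -/
structure Block (L : Type u) [Lattice L] where
  bot : L
  top : L
  complemented : IsComplementedLattice (Set.Icc bot top)
  maximal : ∀ a b : L, IsComplementedLattice (Set.Icc a b) →
    Set.Icc bot top ⊆ Set.Icc a b → Set.Icc a b ⊆ Set.Icc bot top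

/-- The elements of a block. -/
def Block.set {L : Type u} [Lattice L] (B : Block L) : Set L :=
  Set.Icc B.bot B.top

/-- The data of the dissection: blocks overlap if they intersect, every block is indexed by
itself, and the connections are the identity maps of the intersections. -/
def dissectionData (L : Type u) [Lattice L] (skel : Lattice (Block L)) :
    ConnectionData (Block L) where
  tol B C := (B.set ∩ C.set).Nonempty
  block B := B.set
  blockLattice B := inferInstanceAs (Lattice (Set.Icc B.bot B.top))
  source _ C _ := {a | (a : L) ∈ C.set}
  target B _ _ := {a | (a : L) ∈ B.set}
  conn _ _ _ :=
    { toFun := fun a => ⟨⟨a.1.1, a.2⟩, a.1.2⟩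
      invFun := fun a => ⟨⟨a.1.1, a.2⟩, a.1.2⟩
      left_inv := fun _ => rfl
      right_inv := fun _ => rfl
      map_rel_iff' := Iff.rfl }

/-- A lattice structure on the set of blocks has the order of the minimum elements of the blocks,
and turns the data of the dissection into an m.c. system. -/
structure IsDissectionSkeleton (L : Type u) [Lattice L] (skel : Lattice (Block L)) : Prop where
  le_iff : ∀ B C : Block L, B ≤ C ↔ B.bot ≤ C.bot
  isModularConnected : IsModularConnected (dissectionData L skel)

/-- The dissection of a modular l.f.f.c. lattice. -/
def ModularLFFCLattice.dissect (L : ModularLFFCLattice.{u}) (skel : Lattice (Block L))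
    (h : IsDissectionSkeleton L skel) : MCSystem.{u} :=
  ⟨Block L, skel, dissectionData L skel, h.isModularConnected⟩

/-! ### The induced maps on isomorphism classes -/

/-- The map on isomorphism classes induced by gluing. -/
def glueClass (sumLat : ∀ C : MCSystem.{u}, Lattice C.Sum)
    (hsum : ∀ C, C.IsSumLattice (sumLat C))
    (hiso : ∀ C C' : MCSystem.{u}, C ≈ C' →
      C.glue (sumLat C) (hsum C) ≈ C'.glue (sumLat C') (hsum C')) :
    Quotient MCSystem.isoSetoid.{u} → Quotient ModularLFFCLattice.isoSetoid.{u} :=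
  Quotient.map (fun C => C.glue (sumLat C) (hsum C)) (fun _ _ h => hiso _ _ h)

/-- The map on isomorphism classes induced by dissection. -/
def dissectClass (skelLat : ∀ L : ModularLFFCLattice.{u}, Lattice (Block L))
    (hskel : ∀ L : ModularLFFCLattice.{u}, IsDissectionSkeleton L (skelLat L))
    (hiso : ∀ L L' : ModularLFFCLattice.{u}, L ≈ L' →
      L.dissect (skelLat L) (hskel L) ≈ L'.dissect (skelLat L') (hskel L')) :
    Quotient ModularLFFCLattice.isoSetoid.{u} → Quotient MCSystem.isoSetoid.{u} :=
  Quotient.map (fun L => L.dissect (skelLat L) (hskel L)) (fun _ _ h => hiso _ _ h)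

end LatticeGluing

open LatticeGluing

/-!
In a modular l.f.f.c. lattice `L` write `a⁺` for the join of `a` and its upper covers, and `a⁻` for
the dual. By modularity `[a, a⁺]` is complemented, and every complemented interval starting at `a`
lies in it; hence `b⁻ ≤ a ↔ b ≤ a⁺` is a Galois connection (`IsLFFC.gc`), and the blocks are the
intervals `[a, b]` with `b = a⁺` and `a = b⁻`. The blocks therefore form a lattice, with joins
computed on bottoms and meets on tops, and the axioms of an m.c. system for the dissection are
statements about end points of intervals (`IsLFFC.isModularConnected_dissectionData`).

For the sum, an m.c. system is encoded by the self-dual relation `rel x y a b`, "the connection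
from `x` to `y` sends `a` to `b`" (`OverlapSystem`), so that every statement has its dual for free.
Call a sequence of steps up inside a block or along a connection a path. Paths can be rerouted
through overlapping blocks (`Path.exists_rel`), hence factor through every intermediate index
(`Path.interp`), and they commute with connections (`Path.push`). The latter two make
`p ≲ q`, meaning that there is a path from `p` to some `r` to which `q` is connected, a preorder
whose equivalence is exactly the gluing relation. It agrees with the order of the sum
(`sumLE_toSum_iff`). Two elements over `x` and `y` have a join over `x ⊔ y`: over a higher index
there is a least element reachable by a path from a given one (`exists_least_path`), because the
reachable elements are closed under meets.

Each element of the sum has a highest representative (`exists_highest`), and the block there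
contains all its upper covers (`exists_of_highest_covBy`). As blocks are convex modular sublattices
of the sum, both of Birkhoff's covering conditions hold in the sum, and for locally finite lattices
these imply modularity (`isModularLattice_of_covering_conditions`). The bottom of a block of the
system has its highest representative in that block, so `⊥⁺ = ⊤` holds there, and dually: the blocks
of the system become blocks of the sum, and every block of the sum arises so. This identifies a
system with the dissection of its sum (`isoDissectGlue`). Conversely, in the sum of a dissection the
step from a block `B` to an upper cover `D` is the join with the bottom of `D`, which identifies
the sum of the dissection of `L` with `L` (`glueDissectIso`).
-/

namespace LatticeGluing

/-! ### Induction along covers -/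

/-- Induction along covers in a locally finite order. -/
theorem covBy_induction {S : Type u} [PartialOrder S] (hfin : ∀ a b : S, (Set.Icc a b).Finite)
    {motive : S → Prop} {y : S} (refl : motive y)
    (head : ∀ x w, x ⋖ w → w ≤ y → motive w → motive x) {x : S} (h : x ≤ y) : motive x := by
  let := LocallyFiniteOrder.ofFiniteIcc hfin
  have h' := le_iff_reflTransGen_covBy.1 h
  induction h' using Relation.ReflTransGen.head_induction_on with
  | refl => exact refl
  | head h₁ h₂ ih =>
    have := le_iff_reflTransGen_covBy.2 h₂
    exact head _ _ h₁ this (ih this)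

/-! ### Relational form of a connected system -/

/-- The part of the structure of an m.c. system on which the order of its sum depends, in a form
that is visibly self-dual: the connections are encoded by a single relation, where `rel x y a b`
means that `x ≤_γ y`, that the connection from `x` to `y` is defined at `a`, and that it sends `a`
to `b`. Since sources are nonempty, `x ≤_γ y` is equivalent to `∃ a b, rel x y a b`. -/
structure OverlapSystem {S : Type u} [Lattice S] (L : S → Type u) [∀ x, Lattice (L x)] where
  rel : ∀ x y, L x → L y → Prop
  le : ∀ {x y a b}, rel x y a b → x ≤ y
  le_iff : ∀ {x y a b a' b'}, rel x y a b → rel x y a' b' → (a ≤ a' ↔ b ≤ b')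
  self : ∀ {x a b}, rel x x a b ↔ a = b
  up : ∀ {x y a b}, rel x y a b → ∀ a', a ≤ a' → ∃ b', rel x y a' b'
  down : ∀ {x y a b}, rel x y a b → ∀ b', b' ≤ b → ∃ a', rel x y a' b'
  inf : ∀ {x y a b a' b'}, rel x y a b → rel x y a' b' → rel x y (a ⊓ a') (b ⊓ b')
  sup : ∀ {x y a b a' b'}, rel x y a b → rel x y a' b' → rel x y (a ⊔ a') (b ⊔ b')
  trans : ∀ {x y z a b c}, rel x y a b → rel y z b c → rel x z a c
  interp : ∀ {x z a c}, rel x z a c → ∀ y, x ≤ y → y ≤ z → ∃ b, rel x y a b ∧ rel y z b c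
  amalg_up : ∀ {x y a b d}, rel (x ⊓ y) x d a → rel (x ⊓ y) y d b →
    ∃ c, rel x (x ⊔ y) a c ∧ rel y (x ⊔ y) b c
  amalg_down : ∀ {x y a b c}, rel x (x ⊔ y) a c → rel y (x ⊔ y) b c →
    ∃ d, rel (x ⊓ y) x d a ∧ rel (x ⊓ y) y d b
  tol_sup : ∀ {x y}, (∃ a b, rel x y a b) → ∀ t, ∃ a b, rel (x ⊔ t) (y ⊔ t) a b
  tol_inf : ∀ {x y}, (∃ a b, rel x y a b) → ∀ t, ∃ a b, rel (x ⊓ t) (y ⊓ t) a b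
  tol_join : ∀ {x y z}, (∃ a b, rel x y a b) → (∃ a b, rel x z a b) → ∃ a b, rel x (y ⊔ z) a b
  tol_meet : ∀ {x y z}, (∃ a b, rel y x a b) → (∃ a b, rel z x a b) → ∃ a b, rel (y ⊓ z) x a b
  tol_covBy : ∀ {x y}, x ⋖ y → ∃ a b, rel x y a b
  finite_Icc : ∀ x y : S, (Set.Icc x y).Finite
  finite_block : ∀ x, Finite (L x)
  exists_bot : ∀ x, ∃ a : L x, IsBot a
  exists_top : ∀ x, ∃ a : L x, IsTop a
  not_rel_bot : ∀ {x y a b}, x ⋖ y → IsBot a → ¬ rel x y a b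
  not_rel_top : ∀ {x y a b}, x ⋖ y → IsTop b → ¬ rel x y a b

/-- The family of dual blocks over the dual skeleton. -/
abbrev DualBlock {S : Type u} (L : S → Type u) : Sᵒᵈ → Type u :=
  fun x => (L (OrderDual.ofDual x))ᵒᵈ

namespace OverlapSystem

variable {S : Type u} [Lattice S] {L : S → Type u} [∀ x, Lattice (L x)]

/-- The dual system: skeleton and blocks are dualized and the connections are inverted. -/
def dual (O : OverlapSystem L) : OverlapSystem (DualBlock L) where
  rel x y a b := O.rel (OrderDual.ofDual y) (OrderDual.ofDual x) (OrderDual.ofDual b)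
    (OrderDual.ofDual a)
  le h := O.le h
  le_iff h h' := (O.le_iff h' h).symm
  self := O.self.trans eq_comm
  up h a' ha := O.down h a' ha
  down h a' ha := O.up h a' ha
  inf h h' := O.sup h h'
  sup h h' := O.inf h h'
  trans h h' := O.trans h' h
  interp h y h1 h2 := let ⟨b, hb, hb'⟩ := O.interp h (OrderDual.ofDual y) h2 h1; ⟨b, hb', hb⟩
  amalg_up h h' := O.amalg_down h h'
  amalg_down h h' := O.amalg_up h h'
  tol_sup := fun ⟨a, b, h⟩ t =>
    let ⟨a', b', h'⟩ := O.tol_inf ⟨b, a, h⟩ (OrderDual.ofDual t); ⟨b', a', h'⟩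
  tol_inf := fun ⟨a, b, h⟩ t =>
    let ⟨a', b', h'⟩ := O.tol_sup ⟨b, a, h⟩ (OrderDual.ofDual t); ⟨b', a', h'⟩
  tol_join := fun ⟨a, b, h⟩ ⟨c, d, h'⟩ =>
    let ⟨a', b', h'⟩ := O.tol_meet ⟨b, a, h⟩ ⟨d, c, h'⟩; ⟨b', a', h'⟩
  tol_meet := fun ⟨a, b, h⟩ ⟨c, d, h'⟩ =>
    let ⟨a', b', h'⟩ := O.tol_join ⟨b, a, h⟩ ⟨d, c, h'⟩; ⟨b', a', h'⟩
  tol_covBy h := let ⟨a', b', h'⟩ := O.tol_covBy h.ofDual; ⟨b', a', h'⟩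
  finite_Icc x y := (O.finite_Icc (OrderDual.ofDual y) (OrderDual.ofDual x)).subset
    fun _ hz => ⟨hz.2, hz.1⟩
  finite_block x := O.finite_block (OrderDual.ofDual x)
  exists_bot x := O.exists_top (OrderDual.ofDual x)
  exists_top x := O.exists_bot (OrderDual.ofDual x)
  not_rel_bot h h' := O.not_rel_top h.ofDual h'
  not_rel_top h h' := O.not_rel_bot h.ofDual h'

/-- One step of a path: up inside one block, or along a connection. -/
inductive Step (O : OverlapSystem L) : (Σ x, L x) → (Σ x, L x) → Prop
  | le {x : S} {a b : L x} (h : a ≤ b) : Step O ⟨x, a⟩ ⟨x, b⟩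
  | rel {x y : S} {a : L x} {b : L y} (h : O.rel x y a b) : Step O ⟨x, a⟩ ⟨y, b⟩

/-- The preorder on pairs generated by the orders of the blocks and by the connections. In the
sum, a path from `(x, a)` to `(y, b)` exists iff `x ≤ y` and `(x, a)` lies below `(y, b)`. -/
def Path (O : OverlapSystem L) : (Σ x, L x) → (Σ x, L x) → Prop :=
  Relation.ReflTransGen O.Step

/-- A pair, read in the dual system. -/
abbrev toDualPair (p : Σ x, L x) : Σ x, DualBlock L x :=
  ⟨OrderDual.toDual p.1, OrderDual.toDual p.2⟩

variable (O : OverlapSystem L)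

theorem rel_refl (x : S) (a : L x) : O.rel x x a a := O.self.2 rfl

theorem step_dual {p q : Σ x, L x} (h : O.Step p q) :
    O.dual.Step (toDualPair q) (toDualPair p) := by
  cases h with
  | le h => exact .le h
  | rel h => exact .rel h

theorem path_dual {p q : Σ x, L x} (h : O.Path p q) :
    O.dual.Path (toDualPair q) (toDualPair p) := by
  induction h with
  | refl => exact .refl
  | tail _ h ih => exact .head (O.step_dual h) ih

theorem path_of_dual {p q : Σ x, L x} (h : O.dual.Path (toDualPair q) (toDualPair p)) :
    O.Path p q :=
  O.dual.path_dual h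

variable {O}

theorem Path.refl (p : Σ x, L x) : O.Path p p := Relation.ReflTransGen.refl

theorem Path.trans {p q r : Σ x, L x} (h : O.Path p q) (h' : O.Path q r) : O.Path p r :=
  Relation.ReflTransGen.trans h h'

theorem Path.of_le {x : S} {a b : L x} (h : a ≤ b) : O.Path ⟨x, a⟩ ⟨x, b⟩ :=
  .single (.le h)

theorem Path.of_rel {x y : S} {a : L x} {b : L y} (h : O.rel x y a b) : O.Path ⟨x, a⟩ ⟨y, b⟩ :=
  .single (.rel h)

theorem Path.fst_le {p q : Σ x, L x} (h : O.Path p q) : p.1 ≤ q.1 := by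
  induction h with
  | refl => exact le_rfl
  | tail _ h ih =>
    cases h with
    | le _ => exact ih
    | rel h => exact ih.trans (O.le h)

/-- Paths are confluent with connections: a path to `q` may be rerouted through any index `v`
below `q.1` which overlaps the starting index from above. -/
theorem Path.exists_rel {p q : Σ x, L x} (h : O.Path p q) :
    ∀ v, v ≤ q.1 → (∃ a b, O.rel p.1 v a b) →
      ∃ a c, p.2 ≤ a ∧ O.rel p.1 v a c ∧ O.Path ⟨v, c⟩ q := by
  induction h using Relation.ReflTransGen.head_induction_on with
  | refl =>
    rintro v hv ⟨a, b, h⟩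
    obtain rfl : v = q.1 := le_antisymm hv (O.le h)
    exact ⟨q.2, q.2, le_rfl, O.rel_refl _ _, .refl q⟩
  | head h hq ih =>
    intro v hv hT
    cases h with
    | le h =>
      obtain ⟨a, c, ha, hac, hc⟩ := ih v hv hT
      exact ⟨a, c, h.trans ha, hac, hc⟩
    | @rel x w a c₁ h =>
      have hw : w ≤ q.1 := Path.fst_le hq
      have hTz : ∃ a b, O.rel x (w ⊔ v) a b := O.tol_join ⟨_, _, h⟩ hT
      have hwz : ∃ a b, O.rel w (w ⊔ v) a b := by
        have := O.tol_sup hT w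
        rwa [sup_eq_right.2 (O.le h), sup_comm] at this
      obtain ⟨c', d, hc', hcd, hd⟩ := ih (w ⊔ v) (sup_le hw hv) hwz
      obtain ⟨a₀, d₀, h₀⟩ := hTz
      obtain ⟨d₁, h₁⟩ := O.up h₀ (a₀ ⊔ a) le_sup_left
      obtain ⟨c₂, h₂, h₃⟩ := O.interp h₁ w (O.le h) le_sup_left
      -- Meeting with `c'` brings the element back into the image of the block at `x`.
      have h₄ := O.inf h₃ hcd
      obtain ⟨a₅, h₅⟩ := O.down h₂ (c₂ ⊓ c') inf_le_left
      have hle : a ≤ a₅ :=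
        (O.le_iff h h₅).2 (le_inf ((O.le_iff h h₂).1 le_sup_right) hc')
      obtain ⟨c, h₆, h₇⟩ := O.interp (O.trans h₅ h₄) v (by obtain ⟨_, _, h⟩ := hT; exact O.le h)
        le_sup_right
      exact ⟨a₅, c, hle, h₆, ((Path.of_rel h₇).trans (.of_le inf_le_right)).trans hd⟩

/-- A path can be factored at every index between those of its ends. -/
theorem Path.interp {p q : Σ x, L x} (h : O.Path p q) {v : S} (hp : p.1 ≤ v) (hq : v ≤ q.1) :
    ∃ c, O.Path p ⟨v, c⟩ ∧ O.Path ⟨v, c⟩ q := by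
  obtain ⟨x, a⟩ := p
  replace hp : x ≤ v := hp
  revert a
  refine covBy_induction O.finite_Icc (y := v) (motive := fun x => ∀ a : L x, O.Path ⟨x, a⟩ q →
    ∃ c, O.Path ⟨x, a⟩ ⟨v, c⟩ ∧ O.Path ⟨v, c⟩ q) ?_ ?_ hp
  · exact fun a h => ⟨a, .refl _, h⟩
  · intro x w hxw hwv ih a h
    obtain ⟨a', c, ha, hac, hc⟩ := h.exists_rel w (hwv.trans hq) (O.tol_covBy hxw)
    obtain ⟨d, hd, hd'⟩ := ih c hc
    exact ⟨d, ((Path.of_le ha).trans (.of_rel hac)).trans hd, hd'⟩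

theorem Path.le {x : S} {a b : L x} (h : O.Path ⟨x, a⟩ ⟨x, b⟩) : a ≤ b := by
  have key : ∀ p, O.Path p ⟨x, b⟩ → ∀ a, p = ⟨x, a⟩ → a ≤ b := by
    intro p h
    induction h using Relation.ReflTransGen.head_induction_on with
    | refl => rintro a ⟨⟩; exact le_rfl
    | head h hq ih =>
      rintro a rfl
      cases h with
      | le h => exact h.trans (ih _ rfl)
      | @rel _ w _ c h =>
        obtain rfl : x = w := le_antisymm (O.le h) (Path.fst_le hq)
        obtain rfl := O.self.1 h
        exact ih _ rfl
  exact key _ h _ rfl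

theorem Path.le_of_rel {x y : S} {a a' : L x} {b : L y} (h : O.Path ⟨x, a'⟩ ⟨y, b⟩)
    (hab : O.rel x y a b) : a' ≤ a := by
  obtain ⟨a₁, c, h₁, h₂, h₃⟩ := h.exists_rel y le_rfl ⟨a, b, hab⟩
  exact h₁.trans ((O.le_iff h₂ hab).2 h₃.le)

theorem Path.le_of_rel' {x y : S} {a : L x} {b b' : L y} (h : O.Path ⟨x, a⟩ ⟨y, b'⟩)
    (hab : O.rel x y a b) : b ≤ b' :=
  Path.le_of_rel (O := O.dual) (O.path_dual h) hab

/-- Connections commute with paths: parallel to a connection, a path can be pushed up. -/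
theorem Path.push {m q : Σ x, L x} (h : O.Path m q) :
    ∀ p : Σ x, L x, O.rel m.1 p.1 m.2 p.2 → ∃ s : Σ x, L x, O.rel q.1 s.1 q.2 s.2 ∧ O.Path p s := by
  induction h using Relation.ReflTransGen.head_induction_on with
  | refl => exact fun p h => ⟨p, h, .refl p⟩
  | head h hq ih =>
    rintro ⟨y, b⟩ hp
    cases h with
    | le h =>
      obtain ⟨b', hb'⟩ := O.up hp _ h
      obtain ⟨s, hs, hs'⟩ := ih ⟨y, b'⟩ hb'
      exact ⟨s, hs, (Path.of_le ((O.le_iff hp hb').1 h)).trans hs'⟩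
    | @rel x w a c h =>
      obtain ⟨d, h₁, h₂⟩ := O.interp h (w ⊓ y) (le_inf (O.le h) (O.le hp)) inf_le_left
      obtain ⟨d', h₃, h₄⟩ := O.interp hp (w ⊓ y) (le_inf (O.le h) (O.le hp)) inf_le_right
      obtain rfl : d = d' := le_antisymm ((O.le_iff h₁ h₃).1 le_rfl) ((O.le_iff h₃ h₁).1 le_rfl)
      obtain ⟨e, he, he'⟩ := O.amalg_up h₂ h₄
      obtain ⟨s, hs, hs'⟩ := ih ⟨w ⊔ y, e⟩ he
      exact ⟨s, hs, (Path.of_rel he').trans hs'⟩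

/-! ### The order of the sum, on representatives -/

variable (O)

/-- Two pairs represent the same element of the sum: the connections map them to a common pair. -/
def Eqv (p q : Σ x, L x) : Prop :=
  ∃ r : Σ x, L x, O.rel p.1 r.1 p.2 r.2 ∧ O.rel q.1 r.1 q.2 r.2

/-- The order of the sum, for representing pairs. -/
def Below (p q : Σ x, L x) : Prop :=
  ∃ r : Σ x, L x, O.Path p r ∧ O.rel q.1 r.1 q.2 r.2

variable {O}

theorem Path.below {p q : Σ x, L x} (h : O.Path p q) : O.Below p q :=
  ⟨q, h, O.rel_refl _ _⟩

theorem Below.of_le {x : S} {a b : L x} (h : a ≤ b) : O.Below ⟨x, a⟩ ⟨x, b⟩ :=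
  (Path.of_le h).below

theorem Below.refl (p : Σ x, L x) : O.Below p p := (Path.refl p).below

theorem Below.trans {p q r : Σ x, L x} (h : O.Below p q) (h' : O.Below q r) : O.Below p r := by
  obtain ⟨s, hs, hqs⟩ := h
  obtain ⟨t, ht, hrt⟩ := h'
  obtain ⟨u, hu, hu'⟩ := ht.push s hqs
  exact ⟨u, hs.trans hu', O.trans hrt hu⟩

theorem Eqv.symm {p q : Σ x, L x} (h : O.Eqv p q) : O.Eqv q p :=
  let ⟨r, h₁, h₂⟩ := h; ⟨r, h₂, h₁⟩

theorem Eqv.of_rel {p q : Σ x, L x} (h : O.rel p.1 q.1 p.2 q.2) : O.Eqv p q :=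
  ⟨q, h, O.rel_refl _ _⟩

theorem Eqv.below {p q : Σ x, L x} (h : O.Eqv p q) : O.Below p q :=
  let ⟨r, h₁, h₂⟩ := h; ⟨r, .of_rel h₁, h₂⟩

/-- Equivalent pairs already agree over the join of their indices. -/
theorem Eqv.exists_sup {p q : Σ x, L x} (h : O.Eqv p q) :
    ∃ c, O.rel p.1 (p.1 ⊔ q.1) p.2 c ∧ O.rel q.1 (p.1 ⊔ q.1) q.2 c := by
  obtain ⟨r, h₁, h₂⟩ := h
  have hr : p.1 ⊔ q.1 ≤ r.1 := sup_le (O.le h₁) (O.le h₂)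
  obtain ⟨c, hc, hc'⟩ := O.interp h₁ _ le_sup_left hr
  obtain ⟨d, hd, hd'⟩ := O.interp h₂ _ le_sup_right hr
  obtain rfl : c = d := le_antisymm ((O.le_iff hc' hd').2 le_rfl) ((O.le_iff hd' hc').2 le_rfl)
  exact ⟨c, hc, hd⟩

theorem Eqv.exists_inf {p q : Σ x, L x} (h : O.Eqv p q) :
    ∃ c, O.rel (p.1 ⊓ q.1) p.1 c p.2 ∧ O.rel (p.1 ⊓ q.1) q.1 c q.2 := by
  obtain ⟨c, h₁, h₂⟩ := h.exists_sup
  exact O.amalg_down h₁ h₂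

theorem Eqv.dual {p q : Σ x, L x} (h : O.Eqv p q) :
    O.dual.Eqv (toDualPair p) (toDualPair q) :=
  let ⟨c, h₁, h₂⟩ := h.exists_inf
  ⟨⟨OrderDual.toDual (p.1 ⊓ q.1), OrderDual.toDual c⟩, h₁, h₂⟩

theorem Eqv.of_dual {p q : Σ x, L x} (h : O.dual.Eqv (toDualPair p) (toDualPair q)) :
    O.Eqv p q :=
  Eqv.dual (O := O.dual) h

theorem Below.dual {p q : Σ x, L x} (h : O.Below p q) :
    O.dual.Below (toDualPair q) (toDualPair p) := by
  obtain ⟨r, h₁, h₂⟩ := h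
  exact Below.trans (Eqv.below (Eqv.dual (Eqv.of_rel h₂))) (O.path_dual h₁).below

theorem Below.of_dual {p q : Σ x, L x} (h : O.dual.Below (toDualPair q) (toDualPair p)) :
    O.Below p q :=
  Below.dual (O := O.dual) h

theorem Below.exists_path_to {p q : Σ x, L x} (h : O.Below p q) :
    ∃ r : Σ x, L x, O.rel r.1 p.1 r.2 p.2 ∧ O.Path r q := by
  obtain ⟨r, h₁, h₂⟩ := h.dual
  exact ⟨⟨OrderDual.ofDual r.1, OrderDual.ofDual r.2⟩, h₂, O.path_of_dual h₁⟩

/-- Inside one block the order of the sum is the order of the block. -/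
theorem Below.le {x : S} {a b : L x} (h : O.Below ⟨x, a⟩ ⟨x, b⟩) : a ≤ b :=
  let ⟨_, h₁, h₂⟩ := h; h₁.le_of_rel h₂

theorem Below.antisymm {p q : Σ x, L x} (h : O.Below p q) (h' : O.Below q p) : O.Eqv p q := by
  obtain ⟨s, hs, hqs⟩ := h
  obtain ⟨t, ht, hpt⟩ := h'
  obtain ⟨u, htu, hsu⟩ := ht.push s hqs
  have hpu := O.trans hpt htu
  obtain ⟨c, h₁, h₂⟩ := O.interp hpu s.1 hs.fst_le hsu.fst_le
  have e : s.2 = c := le_antisymm (hsu.le_of_rel h₂) (hs.le_of_rel' h₁)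
  subst e
  exact ⟨s, h₁, hqs⟩

theorem Eqv.trans {p q r : Σ x, L x} (h : O.Eqv p q) (h' : O.Eqv q r) : O.Eqv p r :=
  (h.below.trans h'.below).antisymm (h'.symm.below.trans h.symm.below)

theorem Eqv.refl (p : Σ x, L x) : O.Eqv p p := .of_rel (O.rel_refl _ _)

/-- Blocks are convex in the sum. -/
theorem Below.exists_eqv {x : S} {a b : L x} {q : Σ x, L x} (h : O.Below ⟨x, a⟩ q)
    (h' : O.Below q ⟨x, b⟩) : ∃ c, O.Eqv q ⟨x, c⟩ := by
  obtain ⟨s, hs, hqs⟩ := h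
  obtain ⟨t, htq, ht⟩ := h'.exists_path_to
  obtain ⟨c, -, hc⟩ := O.interp (O.trans htq hqs) x ht.fst_le hs.fst_le
  exact ⟨c, s, hqs, hc⟩

/-! ### Joins and meets of representatives -/

variable (O)

theorem exists_path {x y : S} (h : x ≤ y) : ∀ a : L x, ∃ b, O.Path ⟨x, a⟩ ⟨y, b⟩ := by
  refine covBy_induction O.finite_Icc (y := y) (motive := fun x => ∀ a : L x, ∃ b, O.Path ⟨x, a⟩ ⟨y, b⟩)
    (fun a => ⟨a, .refl _⟩) ?_ h
  intro x w hxw _ ih a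
  obtain ⟨a₀, b₀, h₀⟩ := O.tol_covBy hxw
  obtain ⟨c, hc⟩ := O.up h₀ (a₀ ⊔ a) le_sup_left
  obtain ⟨b, hb⟩ := ih c
  exact ⟨b, ((Path.of_le le_sup_right).trans (.of_rel hc)).trans hb⟩

theorem exists_path_from {x y : S} (h : x ≤ y) (b : L y) : ∃ a, O.Path ⟨x, a⟩ ⟨y, b⟩ :=
  let ⟨a, ha⟩ := O.dual.exists_path (x := OrderDual.toDual y) (y := OrderDual.toDual x) h
    (OrderDual.toDual b)
  ⟨OrderDual.ofDual a, O.path_of_dual (p := ⟨x, OrderDual.ofDual a⟩) (q := ⟨y, b⟩) ha⟩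

variable {O}

theorem Path.sup {x y : S} {b : L y} : ∀ {a a' : L x}, O.Path ⟨x, a⟩ ⟨y, b⟩ →
    O.Path ⟨x, a'⟩ ⟨y, b⟩ → O.Path ⟨x, a ⊔ a'⟩ ⟨y, b⟩ := by
  intro a a' h h'
  have hxy : x ≤ y := h.fst_le
  revert a a' b
  refine covBy_induction O.finite_Icc (y := y) (motive := fun x => ∀ {b : L y} {a a' : L x},
    O.Path ⟨x, a⟩ ⟨y, b⟩ → O.Path ⟨x, a'⟩ ⟨y, b⟩ → O.Path ⟨x, a ⊔ a'⟩ ⟨y, b⟩) ?_ ?_ hxy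
  · exact fun h h' => .of_le (sup_le h.le h'.le)
  · intro x w hxw hwy ih b a a' h h'
    obtain ⟨a₁, c₁, h₁, h₂, h₃⟩ := h.exists_rel w hwy (O.tol_covBy hxw)
    obtain ⟨a₂, c₂, h₄, h₅, h₆⟩ := h'.exists_rel w hwy (O.tol_covBy hxw)
    exact ((Path.of_le (sup_le_sup h₁ h₄)).trans (.of_rel (O.sup h₂ h₅))).trans (ih h₃ h₆)

theorem Path.inf {x y : S} {a : L x} {b b' : L y} (h : O.Path ⟨x, a⟩ ⟨y, b⟩)
    (h' : O.Path ⟨x, a⟩ ⟨y, b'⟩) : O.Path ⟨x, a⟩ ⟨y, b ⊓ b'⟩ :=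
  O.path_of_dual (Path.sup (O := O.dual) (O.path_dual h) (O.path_dual h'))

variable (O)

/-- Over an index `y ≥ x` there is a least element to which `(x, a)` is connected by a path; in
the sum it is the join of `a` and the bottom of the block at `y`. -/
theorem exists_least_path {x y : S} (h : x ≤ y) (a : L x) :
    ∃ b, O.Path ⟨x, a⟩ ⟨y, b⟩ ∧ ∀ b', O.Path ⟨x, a⟩ ⟨y, b'⟩ → b ≤ b' := by
  have := O.finite_block y
  obtain ⟨b, hb⟩ := (Set.toFinite {b | O.Path ⟨x, a⟩ ⟨y, b⟩}).exists_minimal (O.exists_path h a)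
  exact ⟨b, hb.prop, fun b' hb' => inf_eq_left.1 (hb.eq_of_le (hb.prop.inf hb') inf_le_left)⟩

/-- Any two pairs have a least upper bound, which lives over the join of their indices. -/
theorem exists_join (p q : Σ x, L x) : ∃ c : L (p.1 ⊔ q.1),
    O.Path p ⟨_, c⟩ ∧ O.Path q ⟨_, c⟩ ∧ ∀ r, O.Below p r → O.Below q r → O.Below ⟨_, c⟩ r := by
  obtain ⟨a, ha, ha'⟩ := O.exists_least_path (le_sup_left : p.1 ≤ p.1 ⊔ q.1) p.2
  obtain ⟨b, hb, hb'⟩ := O.exists_least_path (le_sup_right : q.1 ≤ p.1 ⊔ q.1) q.2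
  refine ⟨a ⊔ b, ha.trans (.of_le le_sup_left), hb.trans (.of_le le_sup_right), ?_⟩
  rintro r ⟨s, hs, hrs⟩ ⟨t, ht, hrt⟩
  have hst : O.Eqv s t := (Eqv.of_rel hrs).symm.trans (.of_rel hrt)
  obtain ⟨u, hsu, htu⟩ := hst
  have hpu := hs.trans (.of_rel hsu)
  have hqu := ht.trans (.of_rel htu)
  have hv : p.1 ⊔ q.1 ≤ u.1 := sup_le hpu.fst_le hqu.fst_le
  obtain ⟨a₁, h₁, h₂⟩ := hpu.interp le_sup_left hv
  obtain ⟨b₁, h₃, h₄⟩ := hqu.interp le_sup_right hv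
  exact ⟨u, ((Path.of_le (ha' _ h₁)).trans h₂).sup ((Path.of_le (hb' _ h₃)).trans h₄),
    O.trans hrs hsu⟩

theorem exists_meet (p q : Σ x, L x) : ∃ r, O.Below r p ∧ O.Below r q ∧
    ∀ s, O.Below s p → O.Below s q → O.Below s r := by
  obtain ⟨c, h₁, h₂, h₃⟩ := O.dual.exists_join (toDualPair p) (toDualPair q)
  exact ⟨⟨p.1 ⊓ q.1, c⟩, (O.path_of_dual h₁).below, (O.path_of_dual h₂).below,
    fun s hs hs' => Below.of_dual (h₃ (toDualPair s) hs.dual hs'.dual)⟩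

/-- Intervals of the sum are finite: their elements have representatives over a fixed interval of
the skeleton. -/
theorem exists_finite_between (p q : Σ x, L x) : ∃ F : Set (Σ x, L x), F.Finite ∧
    ∀ r, O.Below p r → O.Below r q → ∃ r' ∈ F, O.Eqv r r' := by
  by_cases hpq : O.Below p q
  · obtain ⟨s, hs, hqs⟩ := hpq
    refine ⟨Sigma.fst ⁻¹' Set.Icc p.1 s.1, ?_, ?_⟩
    · have e : (Sigma.fst ⁻¹' Set.Icc p.1 s.1 : Set (Σ x, L x)) =
          ⋃ x ∈ Set.Icc p.1 s.1, Set.range (Sigma.mk x) := by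
        ext ⟨x, a⟩
        simp
      rw [e]
      refine (O.finite_Icc p.1 s.1).biUnion fun x _ => ?_
      have := O.finite_block x
      exact Set.finite_range _
    · rintro r ⟨w, hw, hrw⟩ hrq
      have hws : O.Below w s :=
        (Eqv.of_rel hrw).symm.below.trans (hrq.trans (Eqv.of_rel hqs).below)
      obtain ⟨t, htw, hts⟩ := hws.exists_path_to
      obtain ⟨c, hc, hc'⟩ := O.interp htw (t.1 ⊔ p.1) le_sup_left (sup_le (O.le htw) hw.fst_le)
      exact ⟨⟨t.1 ⊔ p.1, c⟩, ⟨le_sup_right, sup_le hts.fst_le hs.fst_le⟩, w, hrw, hc'⟩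
  · exact ⟨∅, Set.finite_empty, fun r h h' => (hpq (h.trans h')).elim⟩

/-! ### The highest block containing an element -/

/-- `p.1` is the highest index over which the element of the sum given by `p` is represented.
Maximality suffices, since the indices representing an element are closed under joins. -/
def Highest (p : Σ x, L x) : Prop :=
  ∀ q : Σ x, L x, O.rel p.1 q.1 p.2 q.2 → q.1 = p.1

variable {O}

/-- The bottom of a block belongs to no higher block. -/
theorem eq_of_rel_bot {x y : S} {a : L x} {b : L y} (ha : IsBot a) (h : O.rel x y a b) :
    y = x := by
  let := LocallyFiniteOrder.ofFiniteIcc O.finite_Icc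
  by_contra hne
  obtain ⟨w, hxw, hwy⟩ := exists_covBy_le_of_lt (lt_of_le_of_ne (O.le h) (Ne.symm hne))
  obtain ⟨c, hc, -⟩ := O.interp h w hxw.le hwy
  exact O.not_rel_bot hxw ha hc

variable (O)

theorem highest_bot {x : S} {a : L x} (ha : IsBot a) : O.Highest ⟨x, a⟩ :=
  fun _ h => eq_of_rel_bot ha h

/-- Every element of the sum has a highest representative. Going up to higher blocks containing
`p` strictly shrinks the common part with the block at `p.1`, which is finite. -/
theorem exists_highest (p : Σ x, L x) : ∃ q, O.Eqv p q ∧ O.Highest q := by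
  have := O.finite_block p.1
  let f : (Σ x, L x) → Set (L p.1) := fun q => {a | ∃ b, O.rel p.1 q.1 a b}
  obtain ⟨q, hq, hmin⟩ := exists_minimalFor_of_wellFoundedLT
    (fun q : Σ x, L x => O.rel p.1 q.1 p.2 q.2) f ⟨p, O.rel_refl _ _⟩
  refine ⟨q, .of_rel hq, fun r hr => ?_⟩
  have hpr := O.trans hq hr
  have hsub : f r ⊆ f q := fun a ⟨b, hb⟩ =>
    let ⟨c, hc, _⟩ := O.interp hb q.1 (O.le hq) (O.le hr); ⟨c, hc⟩
  -- If nothing is lost on the way from `q.1` to `r.1`, then the bottom of the block at `q.1`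
  -- belongs to the block at `r.1`.
  obtain ⟨b, hb⟩ := O.exists_bot q.1
  obtain ⟨a, ha⟩ := O.down hq b (hb _)
  obtain ⟨c, hc⟩ := hmin hpr hsub ⟨b, ha⟩
  obtain ⟨b', hb', hc'⟩ := O.interp hc q.1 (O.le hq) (O.le hr)
  obtain rfl : b = b' := le_antisymm (hb _) ((O.le_iff hb' ha).1 le_rfl)
  exact eq_of_rel_bot hb hc'

variable {O}

/-- If `p` is a highest representative, then every element strictly above `p` lies above an
element strictly above `p` which belongs to the same block. -/
theorem Highest.exists_lt {p q : Σ x, L x} (hp : O.Highest p) (h : O.Below p q) :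
    O.Eqv p q ∨ ∃ a, p.2 < a ∧ O.Below ⟨p.1, a⟩ q := by
  obtain ⟨x, a⟩ := p
  obtain ⟨⟨y, b⟩, hs, hqs⟩ := h
  rcases eq_or_lt_of_le hs.fst_le with e | hlt
  · obtain rfl : x = y := e
    rcases eq_or_lt_of_le hs.le with e | hlt
    · obtain rfl : a = b := e
      exact .inl (Eqv.of_rel hqs).symm
    · exact .inr ⟨b, hlt, (Eqv.of_rel (p := q) (q := ⟨x, b⟩) hqs).symm.below⟩
  · let := LocallyFiniteOrder.ofFiniteIcc O.finite_Icc
    obtain ⟨w, hxw, hwy⟩ := exists_covBy_le_of_lt hlt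
    obtain ⟨a', c, h₁, h₂, h₃⟩ := hs.exists_rel w hwy (O.tol_covBy hxw)
    refine .inr ⟨a', lt_of_le_of_ne h₁ ?_, _, (Path.of_rel h₂).trans h₃, hqs⟩
    rintro rfl
    exact hxw.ne (hp ⟨w, c⟩ h₂).symm

theorem Highest.exists_gt {p : Σ x, L x} (hp : O.Highest p) {z : S} (h : p.1 < z) :
    ∃ a, p.2 < a := by
  let := LocallyFiniteOrder.ofFiniteIcc O.finite_Icc
  obtain ⟨w, hxw, hwy⟩ := exists_covBy_le_of_lt h
  obtain ⟨a, c, hac⟩ := O.tol_covBy hxw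
  obtain ⟨d, hd⟩ := O.up hac (a ⊔ p.2) le_sup_left
  refine ⟨a ⊔ p.2, lt_of_le_of_ne le_sup_right fun e => ?_⟩
  rw [← e] at hd
  exact hxw.ne (hp ⟨w, d⟩ hd).symm

variable (O)

theorem below_bot_iff {x y : S} {a : L x} {b : L y} (ha : IsBot a) (hb : IsBot b) :
    O.Below ⟨x, a⟩ ⟨y, b⟩ ↔ x ≤ y := by
  constructor
  · rintro ⟨s, hs, hys⟩
    exact hs.fst_le.trans (eq_of_rel_bot hb hys).le
  · intro h
    obtain ⟨c, hc⟩ := O.exists_path_from h b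
    exact ((Path.of_le (ha c)).trans hc).below

end OverlapSystem
end LatticeGluing

namespace LatticeGluing

/-! ### Locally finite lattices: modularity from the covering conditions -/

section CoveringConditions

variable {α : Type u} [Lattice α]

theorem inf_eq_of_covBy {a b p : α} (h : a ⋖ p) (hb : a ≤ b) (hp : ¬ p ≤ b) : p ⊓ b = a :=
  (h.eq_or_eq (le_inf h.le hb) inf_le_left).resolve_right fun e => hp (inf_eq_left.1 e)

theorem isUpperModularLattice_of_isWeakUpperModularLattice
    (hfin : ∀ a b : α, (Set.Icc a b).Finite) [IsWeakUpperModularLattice α] :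
    IsUpperModularLattice α := by
  have key : ∀ {c b : α}, c ≤ b → ∀ a, c ⋖ a → a ⊓ b = c → b ⋖ a ⊔ b := by
    intro c b hcb
    refine covBy_induction hfin (motive := fun c => ∀ a, c ⋖ a → a ⊓ b = c → b ⋖ a ⊔ b) ?_ ?_ hcb
    · intro a h _
      rwa [sup_eq_left.2 h.le]
    · intro c b₁ hb₁ hb ih a hca hab
      have hnot : ¬ a ≤ b := fun h => hca.ne (hab.symm.trans (inf_eq_left.2 h))
      have e : a ⊓ b₁ = c := inf_eq_of_covBy hca hb₁.le fun h => hnot (h.trans hb)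
      have h₁ : b₁ ⋖ a ⊔ b₁ :=
        covBy_sup_of_inf_covBy_of_inf_covBy_right (by rwa [e]) (by rwa [e])
      have h₂ := ih _ h₁ (inf_eq_of_covBy h₁ hb fun h => hnot (le_sup_left.trans h))
      rwa [sup_assoc, sup_eq_right.2 hb] at h₂
  exact ⟨fun {a b} h => key inf_le_right a h rfl⟩

/-- A locally finite lattice satisfying both of Birkhoff's covering conditions is modular. -/
theorem isModularLattice_of_covering_conditions
    (hfin : ∀ a b : α, (Set.Icc a b).Finite) [IsWeakUpperModularLattice α]
    [IsWeakLowerModularLattice α] : IsModularLattice α := by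
  have hfin' : ∀ a b : αᵒᵈ, (Set.Icc a b).Finite := fun a b =>
    (hfin (OrderDual.ofDual b) (OrderDual.ofDual a)).subset fun _ hz => ⟨hz.2, hz.1⟩
  have : IsUpperModularLattice α := isUpperModularLattice_of_isWeakUpperModularLattice hfin
  have : IsUpperModularLattice αᵒᵈ := isUpperModularLattice_of_isWeakUpperModularLattice hfin'
  have : IsLowerModularLattice α := ⟨fun {a b} h =>
    (covBy_sup_of_inf_covBy_left (α := αᵒᵈ) (a := OrderDual.toDual a) (b := OrderDual.toDual b)
      h.toDual).ofDual⟩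
  let := LocallyFiniteOrder.ofFiniteIcc hfin
  -- There is no pentagon with sides `o < r` and `o ≤ q₁ ⋖ q`.
  have key : ∀ {o r : α}, o ≤ r → ∀ q₁ q, q₁ ⋖ q → o ≤ q₁ → r ⊓ q = o → q ≤ r ⊔ q₁ → False := by
    intro o r hor
    refine covBy_induction hfin (motive := fun o => ∀ q₁ q, q₁ ⋖ q → o ≤ q₁ → r ⊓ q = o →
      q ≤ r ⊔ q₁ → False) ?_ ?_ hor
    · intro q₁ q hq hr _ h
      rw [sup_eq_right.2 hr] at h
      exact hq.lt.not_ge h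
    · intro o r₁ hr₁ hr ih q₁ q hq ho hrq hle
      have hnot : ¬ r₁ ≤ q := fun h => hr₁.lt.not_ge (hrq ▸ le_inf hr h)
      have c₁ : q ⋖ r₁ ⊔ q := covBy_sup_of_inf_covBy_left (by
        rwa [inf_eq_of_covBy hr₁ (ho.trans hq.le) hnot])
      have c₂ : q₁ ⋖ r₁ ⊔ q₁ := covBy_sup_of_inf_covBy_left (by
        rwa [inf_eq_of_covBy hr₁ ho fun h => hnot (h.trans hq.le)])
      have hq₁ : ¬ q ≤ r₁ ⊔ q₁ := by
        intro h
        rcases c₂.eq_or_eq hq.le h with e | e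
        · exact hq.ne e.symm
        · exact hnot (e ▸ le_sup_left)
      have c₃ : r₁ ⊔ q₁ ⋖ r₁ ⊔ q := by
        have := covBy_sup_of_inf_covBy_left (a := q) (b := r₁ ⊔ q₁) (by
          rwa [inf_eq_of_covBy hq le_sup_right hq₁])
        rwa [sup_left_comm, sup_eq_left.2 hq.le] at this
      have e₁ : r ⊓ (r₁ ⊔ q) ⊔ q = r₁ ⊔ q :=
        le_antisymm (sup_le inf_le_right le_sup_right)
          (sup_le_sup_right (le_inf hr le_sup_left) q)
      have c₄ : o ⋖ r ⊓ (r₁ ⊔ q) := by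
        have := inf_covBy_of_covBy_sup_right (a := r ⊓ (r₁ ⊔ q)) (b := q) (by rwa [e₁])
        rwa [inf_assoc, inf_eq_right.2 (le_sup_right : q ≤ r₁ ⊔ q), hrq] at this
      have e₂ : r ⊓ (r₁ ⊔ q) = r₁ :=
        ((c₄.eq_or_eq hr₁.le (le_inf hr le_sup_left)).resolve_left hr₁.ne').symm
      refine ih _ _ c₃ le_sup_left e₂ (sup_le (hr.trans le_sup_left) (hle.trans ?_))
      exact sup_le_sup_left le_sup_right r
  have main : ∀ {p q r : α}, p ≤ r → r ⊓ q ≤ p → r ≤ p ⊔ q → r ≤ p := by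
    intro p q r hpr h₁ h₂
    by_contra hne
    obtain ⟨r₁, hpr₁, hr₁⟩ := exists_le_covBy_of_lt (lt_of_le_not_ge hpr hne)
    refine key (inf_le_left : q ⊓ r ≤ q) r₁ r hr₁ ?_ rfl ?_
    · exact (inf_comm q r ▸ h₁).trans hpr₁
    · exact h₂.trans (sup_comm q p ▸ sup_le_sup_left hpr₁ q)
  refine ⟨fun {x} y {z} hxz => main (q := y) ?_ ?_ ?_⟩
  · exact sup_le (le_inf le_sup_left hxz) (inf_le_inf_right z le_sup_right)
  · exact (le_inf inf_le_right (inf_le_left.trans inf_le_right)).trans le_sup_right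
  · exact inf_le_left.trans (sup_le_sup_right le_sup_left y)

end CoveringConditions

/-! ### Complemented intervals of modular l.f.f.c. lattices -/

section Complemented

variable {L : Type u} [Lattice L]

/-- The interval `[a, b]` is nonempty and complemented. -/
def ComplInterval (a b : L) : Prop :=
  a ≤ b ∧ ∀ x, a ≤ x → x ≤ b → ∃ y, x ⊓ y = a ∧ x ⊔ y = b

theorem isComplementedLattice_Icc_iff {a b : L} :
    IsComplementedLattice (Set.Icc a b) ↔ ComplInterval a b := by
  constructor
  · rintro ⟨hb, hc⟩
    have hab : a ≤ b := (⊥ : Set.Icc a b).2.1.trans (⊥ : Set.Icc a b).2.2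
    have ebot : ((⊥ : Set.Icc a b) : L) = a :=
      le_antisymm (bot_le : ⊥ ≤ (⟨a, le_rfl, hab⟩ : Set.Icc a b)) (⊥ : Set.Icc a b).2.1
    have etop : ((⊤ : Set.Icc a b) : L) = b :=
      le_antisymm (⊤ : Set.Icc a b).2.2 (le_top : (⟨b, hab, le_rfl⟩ : Set.Icc a b) ≤ ⊤)
    refine ⟨hab, fun x hax hxb => ?_⟩
    obtain ⟨y, hy⟩ := hc.exists_isCompl ⟨x, hax, hxb⟩
    refine ⟨y, ?_, ?_⟩
    · exact (congrArg Subtype.val hy.inf_eq_bot).trans ebot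
    · exact (congrArg Subtype.val hy.sup_eq_top).trans etop
  · rintro ⟨hab, h⟩
    have : Fact (a ≤ b) := ⟨hab⟩
    refine ⟨inferInstance, ⟨fun x => ?_⟩⟩
    obtain ⟨y, h₁, h₂⟩ := h x x.2.1 x.2.2
    refine ⟨⟨y, h₁ ▸ inf_le_right, h₂ ▸ le_sup_right⟩, IsCompl.of_eq ?_ ?_⟩
    · exact Subtype.ext h₁
    · exact Subtype.ext h₂

theorem ComplInterval.dual {a b : L} (h : ComplInterval a b) :
    ComplInterval (OrderDual.toDual b) (OrderDual.toDual a) :=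
  ⟨h.1, fun x hx hx' => let ⟨y, h₁, h₂⟩ := h.2 (OrderDual.ofDual x) hx' hx; ⟨y, h₂, h₁⟩⟩

theorem ComplInterval.map {L' : Type u} [Lattice L'] (e : L ≃o L') {a b : L}
    (h : ComplInterval a b) : ComplInterval (e a) (e b) := by
  refine ⟨e.monotone h.1, fun x hx hx' => ?_⟩
  obtain ⟨x, rfl⟩ := e.surjective x
  obtain ⟨y, h₁, h₂⟩ := h.2 x (e.le_iff_le.1 hx) (e.le_iff_le.1 hx')
  exact ⟨e y, by rw [← e.map_inf, h₁], by rw [← e.map_sup, h₂]⟩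

theorem IsLFFC.dual (hL : IsLFFC L) : IsLFFC Lᵒᵈ where
  finite_interval a b :=
    (hL.finite_interval (OrderDual.ofDual b) (OrderDual.ofDual a)).subset
      fun _ hz => ⟨hz.2, hz.1⟩
  finite_upper_covers a :=
    (hL.finite_lower_covers (OrderDual.ofDual a)).subset fun _ hz => hz.ofDual
  finite_lower_covers a :=
    (hL.finite_upper_covers (OrderDual.ofDual a)).subset fun _ hz => hz.ofDual

namespace IsLFFC

variable (hL : IsLFFC L)

/-- The join of `a` and its upper covers: the greatest `b` for which `[a, b]` is complemented, if
the lattice is modular. -/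
noncomputable def upp (a : L) : L :=
  ((hL.finite_upper_covers a).insert a).toFinset.sup' ⟨a, by simp⟩ id

/-- The meet of `a` and its lower covers. -/
noncomputable def low (a : L) : L :=
  OrderDual.ofDual (hL.dual.upp (OrderDual.toDual a))

theorem le_upp (a : L) : a ≤ hL.upp a :=
  Finset.le_sup' (f := id) (by simp)

theorem le_upp_of_covBy {a b : L} (h : a ⋖ b) : b ≤ hL.upp a :=
  Finset.le_sup' (f := id) (by simp [h])

theorem upp_le {a c : L} (h : a ≤ c) (h' : ∀ b, a ⋖ b → b ≤ c) : hL.upp a ≤ c := by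
  refine Finset.sup'_le _ _ fun b hb => ?_
  rcases (by simpa using hb : b = a ∨ a ⋖ b) with rfl | hb
  · exact h
  · exact h' _ hb

theorem exists_covBy_le (hL : IsLFFC L) {a b : L} (h : a < b) : ∃ p, a ⋖ p ∧ p ≤ b := by
  let := LocallyFiniteOrder.ofFiniteIcc hL.finite_interval
  exact exists_covBy_le_of_lt h

theorem le_upp_of_complInterval {a b : L} (h : ComplInterval a b) : b ≤ hL.upp a := by
  -- A complement `d` of `b ⊓ a⁺` in `[a, b]` has no upper cover of `a` below it, so `d = a`.
  obtain ⟨d, h₁, h₂⟩ := h.2 (b ⊓ hL.upp a) (le_inf h.1 (hL.le_upp a)) inf_le_left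
  have had : a ≤ d := h₁ ▸ inf_le_right
  have hdb : d ≤ b := h₂ ▸ le_sup_right
  rcases eq_or_lt_of_le had with rfl | hlt
  · rw [sup_eq_left.2 (le_inf h.1 (hL.le_upp _))] at h₂
    exact inf_eq_left.1 h₂
  · obtain ⟨p, hp, hpd⟩ := hL.exists_covBy_le hlt
    have : p ≤ a := h₁ ▸ le_inf (le_inf (hpd.trans hdb) (hL.le_upp_of_covBy hp)) hpd
    exact (hp.lt.not_ge this).elim

variable [IsModularLattice L]

theorem upp_mono : Monotone hL.upp := by
  intro a b hab
  refine hL.upp_le (hab.trans (hL.le_upp b)) fun p hp => ?_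
  by_cases hpb : p ≤ b
  · exact hpb.trans (hL.le_upp b)
  · have : b ⋖ p ⊔ b := covBy_sup_of_inf_covBy_left (by rwa [inf_eq_of_covBy hp hab hpb])
    exact le_sup_left.trans (hL.le_upp_of_covBy this)

theorem complInterval_upp (a : L) : ComplInterval a (hL.upp a) := by
  refine ⟨hL.le_upp a, fun x hax hxb => ?_⟩
  -- Among the elements meeting `x` in `a`, a maximal one is a complement: by modularity, any atom
  -- of the interval that is not below `x ⊔ y` could be added to it.
  obtain ⟨y, hy⟩ := ((hL.finite_interval a (hL.upp a)).inter_of_left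
    {y | x ⊓ y = a}).exists_maximal ⟨a, ⟨le_rfl, hL.le_upp a⟩, inf_eq_right.2 hax⟩
  obtain ⟨⟨hay, hyb⟩, hxy⟩ := hy.prop
  refine ⟨y, hxy, le_antisymm (sup_le hxb hyb) (hL.upp_le (hax.trans le_sup_left) ?_)⟩
  intro p hp
  by_contra hnot
  have e : p ⊓ (x ⊔ y) = a := inf_eq_of_covBy hp (hax.trans le_sup_left) hnot
  have e' : (y ⊔ p) ⊓ (x ⊔ y) = y := by
    rw [sup_inf_assoc_of_le _ le_sup_right, e, sup_eq_left.2 hay]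
  have hx : x ⊓ (y ⊔ p) = a := by
    refine le_antisymm ?_ (le_inf hax (hay.trans le_sup_left))
    rw [← hxy]
    refine le_inf inf_le_left ?_
    calc x ⊓ (y ⊔ p) ≤ (y ⊔ p) ⊓ (x ⊔ y) := le_inf inf_le_right (inf_le_left.trans le_sup_left)
      _ = y := e'
  have := hy.le_of_ge (y := y ⊔ p)
    ⟨⟨hay.trans le_sup_left, sup_le hyb (hL.le_upp_of_covBy hp)⟩, hx⟩ le_sup_left
  exact hnot (le_sup_right.trans (this.trans le_sup_right))

theorem complInterval_low (a : L) : ComplInterval (hL.low a) a :=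
  (hL.dual.complInterval_upp (OrderDual.toDual a)).dual

theorem gc : GaloisConnection hL.low hL.upp := by
  have h₁ : ∀ b, b ≤ hL.upp (hL.low b) := fun b =>
    hL.le_upp_of_complInterval (hL.complInterval_low b)
  have h₂ : ∀ a, hL.low (hL.upp a) ≤ a := fun a =>
    hL.dual.le_upp_of_complInterval (hL.complInterval_upp a).dual
  have hlow : Monotone hL.low := fun a b hab => hL.dual.upp_mono hab
  exact fun b a => ⟨fun h => (h₁ b).trans (hL.upp_mono h), fun h => (hlow h).trans (h₂ a)⟩

end IsLFFC

end Complemented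

/-! ### Blocks and the dissection -/

section Blocks

variable {L : Type u} [Lattice L]

@[ext]
theorem Block.ext {B C : Block L} (h : B.bot = C.bot) (h' : B.top = C.top) : B = C := by
  obtain ⟨_, _, _, _⟩ := B
  obtain ⟨_, _, _, _⟩ := C
  obtain rfl : _ = _ := h
  obtain rfl : _ = _ := h'
  rfl

theorem Block.complInterval (B : Block L) : ComplInterval B.bot B.top :=
  isComplementedLattice_Icc_iff.1 B.complemented

theorem Block.bot_le_top (B : Block L) : B.bot ≤ B.top := B.complInterval.1

/-- A complemented interval which contains a block has the same end points. -/
theorem Block.eq_of_le (B : Block L) {a b : L} (h : ComplInterval a b) (ha : a ≤ B.bot)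
    (hb : B.top ≤ b) : a = B.bot ∧ b = B.top := by
  have hsub := B.maximal a b (isComplementedLattice_Icc_iff.2 h) (Set.Icc_subset_Icc ha hb)
  exact ⟨le_antisymm ha (hsub ⟨le_rfl, h.1⟩).1, le_antisymm (hsub ⟨h.1, le_rfl⟩).2 hb⟩

theorem Block.inter_nonempty_iff {B C : Block L} :
    (B.set ∩ C.set).Nonempty ↔ B.bot ≤ C.top ∧ C.bot ≤ B.top := by
  constructor
  · rintro ⟨x, hB, hC⟩
    exact ⟨hB.1.trans hC.2, hC.1.trans hB.2⟩
  · rintro ⟨h, h'⟩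
    exact ⟨B.bot ⊔ C.bot, ⟨le_sup_left, sup_le B.bot_le_top h'⟩,
      le_sup_right, sup_le h C.bot_le_top⟩

namespace IsLFFC

variable (hL : IsLFFC L) [IsModularLattice L]

theorem upp_bot (B : Block L) : hL.upp B.bot = B.top :=
  (B.eq_of_le (hL.complInterval_upp B.bot) le_rfl (hL.le_upp_of_complInterval B.complInterval)).2

theorem low_top (B : Block L) : hL.low B.top = B.bot :=
  (B.eq_of_le (hL.complInterval_low B.top) ((hL.gc _ _).2 (hL.upp_bot B).ge) le_rfl).1

/-- An interval whose end points determine each other by `upp` and `low` is a block. -/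
noncomputable def mkBlock (a b : L) (hb : hL.upp a = b) (ha : hL.low b = a) : Block L where
  bot := a
  top := b
  complemented := isComplementedLattice_Icc_iff.2 (hb ▸ hL.complInterval_upp a)
  maximal c d h hsub := by
    have hab : a ≤ b := hb ▸ hL.le_upp a
    have h := isComplementedLattice_Icc_iff.1 h
    have hca : c ≤ a := (hsub ⟨le_rfl, hab⟩).1
    have hbd : b ≤ d := (hsub ⟨hab, le_rfl⟩).2
    refine Set.Icc_subset_Icc ?_ ?_
    · rw [← ha]
      exact (hL.gc _ _).2 (hbd.trans (hL.le_upp_of_complInterval h))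
    · rw [← hb]
      exact (hL.le_upp_of_complInterval h).trans (hL.upp_mono hca)

/-- The highest block containing `x`. -/
noncomputable def highBlock (x : L) : Block L :=
  hL.mkBlock (hL.low (hL.upp x)) (hL.upp x) (hL.gc.u_l_u_eq_u x) rfl

/-- The lowest block containing `x`. -/
noncomputable def lowBlock (x : L) : Block L :=
  hL.mkBlock (hL.low x) (hL.upp (hL.low x)) rfl (hL.gc.l_u_l_eq_l x)

theorem mem_highBlock (x : L) : x ∈ (hL.highBlock x).set :=
  ⟨hL.gc.l_u_le x, hL.le_upp x⟩

theorem bot_le_bot_iff (hL : IsLFFC L) {B C : Block L} : B.bot ≤ C.bot ↔ B.top ≤ C.top := by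
  rw [← hL.low_top B, hL.gc, hL.upp_bot]

theorem highBlock_bot_sup (B C : Block L) : (hL.highBlock (B.bot ⊔ C.bot)).bot = B.bot ⊔ C.bot := by
  refine le_antisymm (hL.gc.l_u_le _) (sup_le ?_ ?_)
  · conv_lhs => rw [← hL.low_top B, ← hL.upp_bot B]
    exact hL.gc.monotone_l (hL.upp_mono le_sup_left)
  · conv_lhs => rw [← hL.low_top C, ← hL.upp_bot C]
    exact hL.gc.monotone_l (hL.upp_mono le_sup_right)

theorem lowBlock_top_inf (B C : Block L) : (hL.lowBlock (B.top ⊓ C.top)).top = B.top ⊓ C.top := by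
  refine le_antisymm (le_inf ?_ ?_) (hL.gc.le_u_l _)
  · conv_rhs => rw [← hL.upp_bot B, ← hL.low_top B]
    exact hL.upp_mono (hL.gc.monotone_l inf_le_left)
  · conv_rhs => rw [← hL.upp_bot C, ← hL.low_top C]
    exact hL.upp_mono (hL.gc.monotone_l inf_le_right)

/-- The lattice of blocks: joins are formed on the bottoms of blocks, meets on the tops. -/
@[reducible]
noncomputable def blockLattice : Lattice (Block L) where
  le B C := B.bot ≤ C.bot
  le_refl B := le_refl B.bot
  le_trans _ _ _ := le_trans (α := L)
  le_antisymm B C h h' := Block.ext (le_antisymm h h')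
    (le_antisymm (hL.bot_le_bot_iff.1 h) (hL.bot_le_bot_iff.1 h'))
  sup B C := hL.highBlock (B.bot ⊔ C.bot)
  inf B C := hL.lowBlock (B.top ⊓ C.top)
  le_sup_left B C := by
    rw [highBlock_bot_sup]
    exact le_sup_left
  le_sup_right B C := by
    rw [highBlock_bot_sup]
    exact le_sup_right
  sup_le B C D h h' := by
    rw [highBlock_bot_sup]
    exact sup_le h h'
  inf_le_left B C := by
    rw [hL.bot_le_bot_iff, lowBlock_top_inf]
    exact inf_le_left
  inf_le_right B C := by
    rw [hL.bot_le_bot_iff, lowBlock_top_inf]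
    exact inf_le_right
  le_inf B C D h h' := by
    rw [hL.bot_le_bot_iff, lowBlock_top_inf]
    exact le_inf (hL.bot_le_bot_iff.1 h) (hL.bot_le_bot_iff.1 h')

/-- Consecutive blocks overlap: the highest block containing `0_C ⊓ 1_B` lies between `B` and `C`
and is not `B`. -/
theorem bot_le_top_of_covBy {B C : Block L}
    (h : letI := hL.blockLattice; B ⋖ C) : C.bot ≤ B.top := by
  let := hL.blockLattice
  have hle : B.bot ≤ C.bot := h.le
  have htop : B.top ≤ C.top := hL.bot_le_bot_iff.1 hle
  set x := C.bot ⊓ B.top with hx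
  have hxC : hL.upp x ≤ C.top := hL.upp_bot C ▸ hL.upp_mono inf_le_left
  have hBx : B.top ≤ hL.upp x := hL.upp_bot B ▸ hL.upp_mono (le_inf hle B.bot_le_top)
  rcases h.eq_or_eq (c := hL.highBlock x) (hL.bot_le_bot_iff.2 hBx) (hL.bot_le_bot_iff.2 hxC)
    with e | e
  · have e' : hL.upp x = B.top := congrArg Block.top e
    by_contra hnot
    have hlt : x < C.bot := lt_of_le_of_ne inf_le_left fun e => hnot (e ▸ inf_le_right)
    obtain ⟨p, hp, hpC⟩ := hL.exists_covBy_le hlt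
    exact hp.lt.not_ge (le_inf hpC ((hL.le_upp_of_covBy hp).trans e'.le))
  · have e' : hL.low (hL.upp x) = C.bot := congrArg Block.bot e
    rw [← e']
    exact (hL.gc.l_u_le x).trans inf_le_right

theorem isLFFC_block : letI := hL.blockLattice; IsLFFC (Block L) := by
  let := hL.blockLattice
  have inj : Function.Injective (Block.bot : Block L → L) := fun B C h =>
    le_antisymm (α := Block L) h.le h.ge
  have inj' : Function.Injective (Block.top : Block L → L) := fun B C h =>
    le_antisymm (α := Block L) (hL.bot_le_bot_iff.2 h.le) (hL.bot_le_bot_iff.2 h.ge)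
  refine ⟨fun B C => ?_, fun B => ?_, fun C => ?_⟩
  · exact ((hL.finite_interval B.bot C.bot).preimage inj.injOn).subset fun D hD => hD
  · exact ((hL.finite_interval B.bot B.top).preimage inj.injOn).subset fun C hC =>
      ⟨hC.le, hL.bot_le_top_of_covBy hC⟩
  · exact ((hL.finite_interval C.bot C.top).preimage inj'.injOn).subset fun B hB =>
      ⟨hL.bot_le_top_of_covBy hB, hL.bot_le_bot_iff.1 hB.le⟩

theorem isModularConnected_dissectionData :
    @IsModularConnected _ hL.blockLattice (dissectionData L hL.blockLattice) := by
  let := hL.blockLattice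
  have top_mono : ∀ {B C : Block L}, B ≤ C → B.top ≤ C.top := fun h => hL.bot_le_bot_iff.1 h
  have bot_sup : ∀ B C : Block L, (B ⊔ C).bot = B.bot ⊔ C.bot := hL.highBlock_bot_sup
  have top_inf : ∀ B C : Block L, (B ⊓ C).top = B.top ⊓ C.top := hL.lowBlock_top_inf
  have tol : ∀ B C : Block L, (dissectionData L hL.blockLattice).tol B C ↔
    B.bot ≤ C.top ∧ C.bot ≤ B.top := fun B C => Block.inter_nonempty_iff
  constructor
  case tolerance =>
    constructor
    · exact fun B => (tol _ _).2 ⟨B.bot_le_top, B.bot_le_top⟩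
    · exact fun B C h => (tol _ _).2 ((tol _ _).1 h).symm
    · intro A B C D h h'
      rw [tol] at h h' ⊢
      rw [bot_sup, bot_sup]
      exact ⟨sup_le (h.1.trans (top_mono le_sup_left)) (h'.1.trans (top_mono le_sup_right)),
        sup_le (h.2.trans (top_mono le_sup_left)) (h'.2.trans (top_mono le_sup_right))⟩
    · intro A B C D h h'
      rw [tol] at h h' ⊢
      have bot_inf_left : ∀ B C : Block L, (B ⊓ C).bot ≤ B.bot := fun B C =>
        (inf_le_left : B ⊓ C ≤ B)
      have bot_inf_right : ∀ B C : Block L, (B ⊓ C).bot ≤ C.bot := fun B C =>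
        (inf_le_right : B ⊓ C ≤ C)
      rw [top_inf, top_inf]
      exact ⟨le_inf ((bot_inf_left _ _).trans h.1) ((bot_inf_right _ _).trans h'.1),
        le_inf ((bot_inf_left _ _).trans h.2) ((bot_inf_right _ _).trans h'.2)⟩
  case skeleton_lffc => exact hL.isLFFC_block
  case block_finite => exact fun B => (hL.finite_interval B.bot B.top).to_subtype
  case block_modular =>
    refine fun B => ⟨fun {x} y {z} hxz => ?_⟩
    exact IsModularLattice.sup_inf_le_assoc_of_le (α := L) y.1 hxz
  case block_complemented => exact fun B => B.complemented
  case source_filter =>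
    rintro B C ⟨hle, h⟩
    rw [tol] at h
    refine Order.IsPFilter.of_def ⟨⟨B.top, B.bot_le_top, le_rfl⟩, h.2, top_mono hle⟩ ?_ ?_
    · intro a ha b hb
      exact ⟨⟨a.1 ⊓ b.1, le_inf a.2.1 b.2.1, inf_le_left.trans a.2.2⟩,
        ⟨le_inf ha.1 hb.1, inf_le_left.trans ha.2⟩, inf_le_left (a := a.1), inf_le_right (a := a.1)⟩
    · intro a b hab ha
      exact ⟨ha.1.trans hab, b.2.2.trans (top_mono hle)⟩
  case target_ideal =>
    rintro B C ⟨hle, h⟩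
    rw [tol] at h
    have hle : B.bot ≤ C.bot := hle
    refine ⟨?_, ⟨⟨C.bot, le_rfl, C.bot_le_top⟩, hle, h.2⟩, ?_⟩
    · intro a b hab ha
      exact ⟨hle.trans b.2.1, le_trans (α := L) hab ha.2⟩
    · intro a ha b hb
      exact ⟨⟨a.1 ⊔ b.1, a.2.1.trans le_sup_left, sup_le a.2.2 b.2.2⟩,
        ⟨ha.1.trans le_sup_left, sup_le ha.2 hb.2⟩, le_sup_left (a := a.1), le_sup_right (a := a.1)⟩
  case source_self => exact fun B _ => Set.eq_univ_of_forall fun a => a.2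
  case target_self => exact fun B _ => Set.eq_univ_of_forall fun a => a.2
  case conn_self => exact fun B _ a => rfl
  case tol_of_overlap =>
    rintro A B C _ _ ⟨b, h, h'⟩
    exact ⟨b.1, h, h'⟩
  case source_trans =>
    intro A B C hAB hBC _
    ext a
    constructor
    · intro ha
      have hB : a.1 ∈ B.set := ⟨le_trans (α := L) hBC.1 ha.1, a.2.2.trans (top_mono hAB.1)⟩
      exact ⟨hB, a.2, ha⟩
    · rintro ⟨_, _, ha⟩
      exact ha
  case target_trans =>
    intro A B C hAB hBC _
    ext c
    constructor
    · intro hc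
      have hB : c.1 ∈ B.set := ⟨le_trans (α := L) hBC.1 c.2.1, hc.2.trans (top_mono hAB.1)⟩
      exact ⟨⟨c.1, hB⟩, c.2, hc, rfl⟩
    · rintro ⟨b, _, hb, rfl⟩
      exact hb
  case conn_trans => exact fun A B C _ _ _ a _ _ _ => rfl
  case inter_target =>
    intro B C _ _ _ _ a ha
    exact ⟨le_trans (α := L) (inf_le_left : B ⊓ C ≤ B) ha.1.1,
      (le_inf ha.1.2 ha.2.2).trans (top_inf B C).ge⟩
  case inter_source =>
    intro B C _ _ _ _ a ha
    exact ⟨(bot_sup B C).le.trans (sup_le ha.1.1 ha.2.1),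
      ha.1.2.trans (top_mono (le_sup_left : B ≤ B ⊔ C))⟩
  case tol_of_covBy =>
    intro B C h
    exact (tol _ _).2 ⟨B.bot_le_top.trans (top_mono h.le), hL.bot_le_top_of_covBy h⟩
  case source_ne =>
    intro B C _ h e
    have := Set.eq_univ_iff_forall.1 e ⟨B.bot, le_rfl, B.bot_le_top⟩
    exact h.lt.not_ge this.1
  case target_ne =>
    intro B C _ h e
    have := Set.eq_univ_iff_forall.1 e ⟨C.top, C.bot_le_top, le_rfl⟩
    exact h.lt.not_ge (hL.bot_le_bot_iff.2 this.2)

end IsLFFC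

end Blocks

/-- The lattice of blocks of a modular l.f.f.c. lattice. -/
@[reducible]
noncomputable def ModularLFFCLattice.skelLattice (L : ModularLFFCLattice.{u}) :
    Lattice (Block L) :=
  letI := L.modular
  L.lffc.blockLattice

theorem ModularLFFCLattice.isDissectionSkeleton (L : ModularLFFCLattice.{u}) :
    IsDissectionSkeleton L L.skelLattice :=
  letI := L.modular
  ⟨fun _ _ => Iff.rfl, L.lffc.isModularConnected_dissectionData⟩

/-! ### The sum lattice -/

namespace MCSystem

variable (C : MCSystem.{u})

/-- `Rel x y a b`: the connection from `x` to `y` is defined at `a` and sends it to `b`. -/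
def Rel (x y : C.skeleton) (a : C.data.block x) (b : C.data.block y) : Prop :=
  ∃ (h : LeTol C.data.tol x y) (ha : a ∈ C.data.source x y h), (C.data.conn x y h ⟨a, ha⟩).1 = b

variable {C}

theorem Rel.mem_source {x y : C.skeleton} {a : C.data.block x} {b : C.data.block y}
    (h : C.Rel x y a b) (hxy : LeTol C.data.tol x y) : a ∈ C.data.source x y hxy :=
  let ⟨_, ha, _⟩ := h; ha

theorem Rel.mem_target {x y : C.skeleton} {a : C.data.block x} {b : C.data.block y}
    (h : C.Rel x y a b) (hxy : LeTol C.data.tol x y) : b ∈ C.data.target x y hxy := by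
  obtain ⟨_, _, rfl⟩ := h
  exact Subtype.property _

theorem rel_of_mem_source {x y : C.skeleton} {h : LeTol C.data.tol x y} {a : C.data.block x}
    (ha : a ∈ C.data.source x y h) : C.Rel x y a (C.data.conn x y h ⟨a, ha⟩).1 :=
  ⟨h, ha, rfl⟩

theorem rel_of_mem_target {x y : C.skeleton} {h : LeTol C.data.tol x y} {b : C.data.block y}
    (hb : b ∈ C.data.target x y h) : ∃ a, C.Rel x y a b := by
  refine ⟨((C.data.conn x y h).symm ⟨b, hb⟩).1, h, Subtype.property _, ?_⟩
  simp

theorem exists_rel_iff {x y : C.skeleton} : (∃ a b, C.Rel x y a b) ↔ LeTol C.data.tol x y := by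
  constructor
  · rintro ⟨_, _, h, _⟩
    exact h
  · intro h
    obtain ⟨a, ha⟩ := (C.isModularConnected.source_filter x y h).Nonempty
    exact ⟨_, _, rel_of_mem_source ha⟩

theorem Rel.le_iff {x y : C.skeleton} {a a' : C.data.block x} {b b' : C.data.block y}
    (h : C.Rel x y a b) (h' : C.Rel x y a' b') : a ≤ a' ↔ b ≤ b' := by
  obtain ⟨hxy, ha, rfl⟩ := h
  obtain ⟨_, ha', rfl⟩ := h'
  exact ((C.data.conn x y hxy).le_iff_le (x := ⟨a, ha⟩) (y := ⟨a', ha'⟩)).symm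

theorem Rel.right_unique {x y : C.skeleton} {a : C.data.block x} {b b' : C.data.block y}
    (h : C.Rel x y a b) (h' : C.Rel x y a b') : b = b' :=
  le_antisymm ((h.le_iff h').1 le_rfl) ((h'.le_iff h).1 le_rfl)

theorem Rel.left_unique {x y : C.skeleton} {a a' : C.data.block x} {b : C.data.block y}
    (h : C.Rel x y a b) (h' : C.Rel x y a' b) : a = a' :=
  le_antisymm ((h.le_iff h').2 le_rfl) ((h'.le_iff h).2 le_rfl)

theorem Rel.up {x y : C.skeleton} {a a' : C.data.block x} {b : C.data.block y}
    (h : C.Rel x y a b) (ha : a ≤ a') : ∃ b', C.Rel x y a' b' := by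
  obtain ⟨hxy, hs, -⟩ := h
  exact ⟨_, rel_of_mem_source ((C.isModularConnected.source_filter x y hxy).IsLowerSet ha hs)⟩

theorem Rel.down {x y : C.skeleton} {a : C.data.block x} {b b' : C.data.block y}
    (h : C.Rel x y a b) (hb : b' ≤ b) : ∃ a', C.Rel x y a' b' :=
  let ⟨hxy, _⟩ := h
  rel_of_mem_target
    ((C.isModularConnected.target_ideal x y hxy).IsLowerSet hb (h.mem_target hxy))

theorem Rel.inf {x y : C.skeleton} {a a' : C.data.block x} {b b' : C.data.block y}
    (h : C.Rel x y a b) (h' : C.Rel x y a' b') : C.Rel x y (a ⊓ a') (b ⊓ b') := by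
  have hxy := exists_rel_iff.1 ⟨_, _, h⟩
  obtain ⟨c, hc, hca, hca'⟩ := (C.isModularConnected.source_filter x y hxy).Directed _
    (h.mem_source hxy) _ (h'.mem_source hxy)
  obtain ⟨e, he⟩ := (rel_of_mem_source hc).up (a' := a ⊓ a') (le_inf hca hca')
  obtain ⟨d, hd⟩ := h.down (b' := b ⊓ b') inf_le_left
  have h₁ : e ≤ b ⊓ b' := le_inf ((he.le_iff h).1 inf_le_left) ((he.le_iff h').1 inf_le_right)
  have h₂ : b ⊓ b' ≤ e :=
    (hd.le_iff he).1 (le_inf ((hd.le_iff h).2 inf_le_left) ((hd.le_iff h').2 inf_le_right))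
  rwa [← le_antisymm h₁ h₂]

theorem Rel.sup {x y : C.skeleton} {a a' : C.data.block x} {b b' : C.data.block y}
    (h : C.Rel x y a b) (h' : C.Rel x y a' b') : C.Rel x y (a ⊔ a') (b ⊔ b') := by
  have hxy := exists_rel_iff.1 ⟨_, _, h⟩
  obtain ⟨c, hc, hcb, hcb'⟩ := (C.isModularConnected.target_ideal x y hxy).Directed _
    (h.mem_target hxy) _ (h'.mem_target hxy)
  obtain ⟨d, hd⟩ := rel_of_mem_target hc
  obtain ⟨e, he⟩ := hd.down (b' := b ⊔ b') (sup_le hcb hcb')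
  obtain ⟨f, hf⟩ := h.up (a' := a ⊔ a') le_sup_left
  have h₁ : a ⊔ a' ≤ e := sup_le ((h.le_iff he).2 le_sup_left) ((h'.le_iff he).2 le_sup_right)
  have h₂ : e ≤ a ⊔ a' :=
    (he.le_iff hf).2 (sup_le ((h.le_iff hf).1 le_sup_left) ((h'.le_iff hf).1 le_sup_right))
  rwa [le_antisymm h₁ h₂]

theorem Rel.interp {x y z : C.skeleton} {a : C.data.block x} {c : C.data.block z}
    (h : C.Rel x z a c) (hxy : x ≤ y) (hyz : y ≤ z) :
    ∃ b, C.Rel x y a b ∧ C.Rel y z b c := by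
  obtain ⟨hxz, ha, rfl⟩ := h
  obtain ⟨h₁, h₂⟩ := LeTol.of_between C.isModularConnected.tolerance hxy hyz hxz.2
  have hm := ha
  rw [C.isModularConnected.source_trans x y z h₁ h₂ hxz] at hm
  obtain ⟨ha', hb⟩ := hm
  exact ⟨_, rel_of_mem_source ha', h₂, hb.2,
    (C.isModularConnected.conn_trans x y z h₁ h₂ hxz a ha ha' hb.2).symm⟩

theorem Rel.trans {x y z : C.skeleton} {a : C.data.block x} {b : C.data.block y}
    {c : C.data.block z} (h : C.Rel x y a b) (h' : C.Rel y z b c) : C.Rel x z a c := by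
  obtain ⟨hxy, ha, rfl⟩ := h
  obtain ⟨hyz, hb, rfl⟩ := h'
  have hm := And.intro (rel_of_mem_source ha |>.mem_target hxy) hb
  have hxz : LeTol C.data.tol x z :=
    ⟨hxy.1.trans hyz.1, C.isModularConnected.tol_of_overlap x y z hxy hyz ⟨_, hm⟩⟩
  have ha' : a ∈ C.data.source x z hxz := by
    rw [C.isModularConnected.source_trans x y z hxy hyz hxz]
    exact ⟨ha, hm⟩
  exact ⟨hxz, ha', C.isModularConnected.conn_trans x y z hxy hyz hxz a ha' ha hb⟩

theorem tol_of_leTol_sup {x y : C.skeleton} (hx : LeTol C.data.tol x (x ⊔ y))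
    (hy : LeTol C.data.tol y (x ⊔ y)) : C.data.tol x y := by
  have T := C.isModularConnected.tolerance
  simpa using T.inf _ _ _ _ hx.2 (T.symm _ _ hy.2)

theorem tol_of_leTol_inf {x y : C.skeleton} (hx : LeTol C.data.tol (x ⊓ y) x)
    (hy : LeTol C.data.tol (x ⊓ y) y) : C.data.tol x y := by
  have T := C.isModularConnected.tolerance
  simpa using T.sup _ _ _ _ (T.symm _ _ hx.2) hy.2

variable (C)

/-- The relational form of an m.c. system. -/
def overlap : OverlapSystem C.data.block where
  rel := C.Rel
  le h := h.1.1
  le_iff h h' := h.le_iff h'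
  self := by
    intro x a b
    have hx : LeTol C.data.tol x x := ⟨le_rfl, C.isModularConnected.tolerance.refl x⟩
    have ha : a ∈ C.data.source x x hx := by
      rw [C.isModularConnected.source_self]
      trivial
    have e := C.isModularConnected.conn_self x hx ⟨a, ha⟩
    constructor
    · rintro ⟨_, _, rfl⟩
      exact e.symm
    · rintro rfl
      exact ⟨hx, ha, e⟩
  up h _ ha := h.up ha
  down h _ hb := h.down hb
  inf h h' := h.inf h'
  sup h h' := h.sup h'
  trans h h' := h.trans h'
  interp h _ h₁ h₂ := h.interp h₁ h₂
  amalg_up := by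
    intro x y a b d h h'
    have hx := exists_rel_iff.1 ⟨_, _, h⟩
    have hy := exists_rel_iff.1 ⟨_, _, h'⟩
    have t := tol_of_leTol_inf hx hy
    obtain ⟨-, -, -, -, hxy⟩ := LeTol.of_tol C.isModularConnected.tolerance t
    have hc := rel_of_mem_source <| C.isModularConnected.inter_source x y t hx hy hxy
      ⟨h.mem_source hx, h'.mem_source hy⟩
    obtain ⟨a', h₁, h₂⟩ := hc.interp inf_le_left (le_sup_left : x ≤ x ⊔ y)
    obtain ⟨b', h₃, h₄⟩ := hc.interp inf_le_right (le_sup_right : y ≤ x ⊔ y)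
    obtain rfl := h₁.right_unique h
    obtain rfl := h₃.right_unique h'
    exact ⟨_, h₂, h₄⟩
  amalg_down := by
    intro x y a b c h h'
    have hx := exists_rel_iff.1 ⟨_, _, h⟩
    have hy := exists_rel_iff.1 ⟨_, _, h'⟩
    have t := tol_of_leTol_sup hx hy
    obtain ⟨-, -, -, -, hxy⟩ := LeTol.of_tol C.isModularConnected.tolerance t
    obtain ⟨d, hd⟩ := rel_of_mem_target <| C.isModularConnected.inter_target x y t hx hy hxy
      ⟨h.mem_target hx, h'.mem_target hy⟩
    obtain ⟨a', h₁, h₂⟩ := hd.interp inf_le_left (le_sup_left : x ≤ x ⊔ y)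
    obtain ⟨b', h₃, h₄⟩ := hd.interp inf_le_right (le_sup_right : y ≤ x ⊔ y)
    obtain rfl := h₂.left_unique h
    obtain rfl := h₄.left_unique h'
    exact ⟨d, h₁, h₃⟩
  tol_sup h t := by
    rw [exists_rel_iff] at h ⊢
    have T := C.isModularConnected.tolerance
    exact ⟨sup_le_sup_right h.1 t, T.sup _ _ _ _ h.2 (T.refl t)⟩
  tol_inf h t := by
    rw [exists_rel_iff] at h ⊢
    have T := C.isModularConnected.tolerance
    exact ⟨inf_le_inf_right t h.1, T.inf _ _ _ _ h.2 (T.refl t)⟩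
  tol_join := by
    intro x y z h h'
    rw [exists_rel_iff] at h h' ⊢
    have := C.isModularConnected.tolerance.sup _ _ _ _ h.2 h'.2
    rw [sup_idem] at this
    exact ⟨h.1.trans le_sup_left, this⟩
  tol_meet := by
    intro x y z h h'
    rw [exists_rel_iff] at h h' ⊢
    have := C.isModularConnected.tolerance.inf _ _ _ _ h.2 h'.2
    rw [inf_idem] at this
    exact ⟨inf_le_left.trans h.1, this⟩
  tol_covBy h := exists_rel_iff.2 ⟨h.le, C.isModularConnected.tol_of_covBy _ _ h⟩
  finite_Icc := C.isModularConnected.skeleton_lffc.finite_interval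
  finite_block := C.isModularConnected.block_finite
  exists_bot x := by
    obtain ⟨_, _⟩ := C.isModularConnected.block_complemented x
    exact ⟨⊥, isBot_bot⟩
  exists_top x := by
    obtain ⟨_, _⟩ := C.isModularConnected.block_complemented x
    exact ⟨⊤, isTop_top⟩
  not_rel_bot := by
    rintro x y a b hxy ha ⟨h, hs, -⟩
    exact C.isModularConnected.source_ne x y h hxy <| Set.eq_univ_of_forall fun c =>
      (C.isModularConnected.source_filter x y h).IsLowerSet (ha c) hs
  not_rel_top := by
    intro x y a b hxy hb hab
    have h := exists_rel_iff.1 ⟨_, _, hab⟩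
    exact C.isModularConnected.target_ne x y h hxy <| Set.eq_univ_of_forall fun c =>
      (C.isModularConnected.target_ideal x y h).IsLowerSet (hb c) (hab.mem_target h)

theorem sim_iff_eqv {p q : C.Pairs} : C.Sim p q ↔ C.overlap.Eqv p q := by
  constructor
  · rintro ⟨-, hx, hy, ha, hb, e⟩
    exact ⟨⟨p.1 ⊔ q.1, _⟩, ⟨hx, ha, rfl⟩, ⟨hy, hb, e.symm⟩⟩
  · intro h
    obtain ⟨c, ⟨hx, ha, e⟩, ⟨hy, hb, e'⟩⟩ := h.exists_sup
    exact ⟨tol_of_leTol_sup hx hy, hx, hy, ha, hb, e.trans e'.symm⟩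

theorem equivalence_sim : Equivalence C.Sim where
  refl _ := C.sim_iff_eqv.2 (.refl _)
  symm h := C.sim_iff_eqv.2 (C.sim_iff_eqv.1 h).symm
  trans h h' := C.sim_iff_eqv.2 ((C.sim_iff_eqv.1 h).trans (C.sim_iff_eqv.1 h'))

/-- The element of the sum represented by a pair. -/
def toSum (p : C.Pairs) : C.Sum := Quot.mk _ p

theorem toSum_surjective : Function.Surjective C.toSum := Quot.mk_surjective

variable {C}

theorem toSum_eq_iff {p q : C.Pairs} : C.toSum p = C.toSum q ↔ C.overlap.Eqv p q := by
  rw [← C.sim_iff_eqv]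
  exact ⟨fun h => C.equivalence_sim.eqvGen_iff.1 (Quot.eqvGen_exact h), fun h => Quot.sound h⟩

theorem sumLE_of_path {p q : C.Pairs} (h : C.overlap.Path p q) :
    ∃ (n : ℕ) (x : Fin n → C.skeleton) (c : Fin (n + 1) → C.Sum),
      (Monotone x ∧ ∀ i, p.1 ≤ x i) ∧ (∀ i : Fin n, C.LeAt (x i) (c i.castSucc) (c i.succ)) ∧
        c 0 = C.toSum p ∧ c (Fin.last n) = C.toSum q := by
  induction h using Relation.ReflTransGen.head_induction_on with
  | refl =>
    exact ⟨0, Fin.elim0, fun _ => C.toSum q, ⟨fun i => i.elim0, fun i => i.elim0⟩,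
      fun i => i.elim0, rfl, rfl⟩
  | head h _ ih =>
    obtain ⟨n, x, c, ⟨hx, hle⟩, hc, h₀, h₁⟩ := ih
    cases h with
    | @le y a b h =>
      refine ⟨n + 1, Fin.cons y x, Fin.cons (C.toSum ⟨y, a⟩) c, ⟨?_, ?_⟩, ?_, rfl, ?_⟩
      · intro i j hij
        induction i using Fin.cases with
        | zero =>
          induction j using Fin.cases with
          | zero => exact le_rfl
          | succ j => simpa using hle j
        | succ i =>
          induction j using Fin.cases with
          | zero => exact absurd hij (by simp)
          | succ j => simpa using hx (Fin.succ_le_succ_iff.1 hij)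
      · intro i
        induction i using Fin.cases with
        | zero => exact le_rfl
        | succ i => simpa using hle i
      · intro i
        induction i using Fin.cases with
        | zero => exact ⟨a, b, rfl, h₀.symm, h⟩
        | succ i => exact hc i
      · rw [← Fin.succ_last, Fin.cons_succ, h₁]
    | rel h =>
      refine ⟨n, x, c, ⟨hx, fun i => (C.overlap.le h).trans (hle i)⟩, hc, ?_, h₁⟩
      rw [h₀]
      exact toSum_eq_iff.2 (OverlapSystem.Eqv.symm (.of_rel h))

theorem sumLE_toSum_iff {p q : C.Pairs} : C.SumLE (C.toSum p) (C.toSum q) ↔ C.overlap.Below p q := by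
  constructor
  · rintro ⟨n, x, c, -, hc, h₀, h₁⟩
    have key : ∀ (i : Fin (n + 1)) (r : C.Pairs), C.toSum r = c i → C.overlap.Below p r := by
      intro i
      induction i using Fin.induction with
      | zero => exact fun r hr => (toSum_eq_iff.1 (h₀.symm.trans hr.symm)).below
      | succ i ih =>
        intro r hr
        obtain ⟨a, b, ha, hb, hab⟩ := hc i
        exact (ih ⟨x i, a⟩ ha).trans
          ((OverlapSystem.Below.of_le hab).trans (toSum_eq_iff.1 (hb.trans hr.symm)).below)
    exact key _ q h₁.symm
  · rintro ⟨s, hs, hq⟩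
    obtain ⟨n, x, c, ⟨hx, -⟩, hc, h₀, h₁⟩ := sumLE_of_path hs
    exact ⟨n, x, c, hx, hc, h₀, h₁.trans (toSum_eq_iff.2 (OverlapSystem.Eqv.symm (.of_rel hq)))⟩

theorem exists_sumLE_sup (p q : C.Sum) : ∃ s, C.SumLE p s ∧ C.SumLE q s ∧
    ∀ r, C.SumLE p r → C.SumLE q r → C.SumLE s r := by
  obtain ⟨p, rfl⟩ := C.toSum_surjective p
  obtain ⟨q, rfl⟩ := C.toSum_surjective q
  obtain ⟨c, h₁, h₂, h₃⟩ := C.overlap.exists_join p q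
  refine ⟨C.toSum ⟨_, c⟩, sumLE_toSum_iff.2 h₁.below, sumLE_toSum_iff.2 h₂.below, ?_⟩
  intro r
  obtain ⟨r, rfl⟩ := C.toSum_surjective r
  simp only [sumLE_toSum_iff]
  exact h₃ r

theorem exists_sumLE_inf (p q : C.Sum) : ∃ s, C.SumLE s p ∧ C.SumLE s q ∧
    ∀ r, C.SumLE r p → C.SumLE r q → C.SumLE r s := by
  obtain ⟨p, rfl⟩ := C.toSum_surjective p
  obtain ⟨q, rfl⟩ := C.toSum_surjective q
  obtain ⟨s, h₁, h₂, h₃⟩ := C.overlap.exists_meet p q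
  refine ⟨C.toSum s, sumLE_toSum_iff.2 h₁, sumLE_toSum_iff.2 h₂, ?_⟩
  intro r
  obtain ⟨r, rfl⟩ := C.toSum_surjective r
  simp only [sumLE_toSum_iff]
  exact h₃ r

variable (C)

/-- The lattice structure of the sum. -/
noncomputable instance sumLattice : Lattice C.Sum where
  le := C.SumLE
  le_refl p := by
    obtain ⟨p, rfl⟩ := C.toSum_surjective p
    exact sumLE_toSum_iff.2 (.refl p)
  le_trans p q r := by
    obtain ⟨p, rfl⟩ := C.toSum_surjective p
    obtain ⟨q, rfl⟩ := C.toSum_surjective q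
    obtain ⟨r, rfl⟩ := C.toSum_surjective r
    simp only [sumLE_toSum_iff]
    exact OverlapSystem.Below.trans
  le_antisymm p q := by
    obtain ⟨p, rfl⟩ := C.toSum_surjective p
    obtain ⟨q, rfl⟩ := C.toSum_surjective q
    simp only [sumLE_toSum_iff]
    exact fun h h' => toSum_eq_iff.2 (h.antisymm h')
  sup p q := (exists_sumLE_sup p q).choose
  inf p q := (exists_sumLE_inf p q).choose
  le_sup_left p q := (exists_sumLE_sup p q).choose_spec.1
  le_sup_right p q := (exists_sumLE_sup p q).choose_spec.2.1
  sup_le p q r := (exists_sumLE_sup p q).choose_spec.2.2 r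
  inf_le_left p q := (exists_sumLE_inf p q).choose_spec.1
  inf_le_right p q := (exists_sumLE_inf p q).choose_spec.2.1
  le_inf r p q := (exists_sumLE_inf p q).choose_spec.2.2 r

variable {C}

theorem toSum_le_iff {p q : C.Pairs} : C.toSum p ≤ C.toSum q ↔ C.overlap.Below p q := sumLE_toSum_iff

variable (C)

/-- The canonical map of a block to the sum, as an order embedding. -/
noncomputable def inclEmb (x : C.skeleton) : C.data.block x ↪o C.Sum :=
  OrderEmbedding.ofMapLEIff (C.incl x) fun _ _ =>
    toSum_le_iff.trans ⟨OverlapSystem.Below.le, OverlapSystem.Below.of_le⟩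

theorem ordConnected_range_inclEmb (x : C.skeleton) : (Set.range (C.inclEmb x)).OrdConnected := by
  refine ⟨?_⟩
  rintro _ ⟨a, rfl⟩ _ ⟨b, rfl⟩ q ⟨h, h'⟩
  obtain ⟨q, rfl⟩ := C.toSum_surjective q
  obtain ⟨c, hc⟩ := OverlapSystem.Below.exists_eqv (toSum_le_iff.1 h) (toSum_le_iff.1 h')
  exact ⟨c, (toSum_eq_iff.2 hc).symm⟩

variable {C}

theorem exists_inclEmb_eq {x : C.skeleton} {a b : C.data.block x} {q : C.Sum}
    (h : C.inclEmb x a ≤ q) (h' : q ≤ C.inclEmb x b) : ∃ c, C.inclEmb x c = q :=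
  (C.ordConnected_range_inclEmb x).out ⟨a, rfl⟩ ⟨b, rfl⟩ ⟨h, h'⟩

theorem inclEmb_covBy {x : C.skeleton} {a b : C.data.block x} :
    C.inclEmb x a ⋖ C.inclEmb x b ↔ a ⋖ b :=
  (C.ordConnected_range_inclEmb x).apply_covBy_apply_iff _

theorem inclEmb_sup {x : C.skeleton} (a b : C.data.block x) :
    C.inclEmb x (a ⊔ b) = C.inclEmb x a ⊔ C.inclEmb x b := by
  have h : C.inclEmb x a ⊔ C.inclEmb x b ≤ C.inclEmb x (a ⊔ b) :=
    sup_le ((C.inclEmb x).monotone le_sup_left) ((C.inclEmb x).monotone le_sup_right)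
  obtain ⟨c, hc⟩ := exists_inclEmb_eq le_sup_left h
  refine le_antisymm ?_ h
  rw [← hc, OrderEmbedding.le_iff_le]
  refine sup_le ?_ ?_ <;> rw [← (C.inclEmb x).le_iff_le, hc]
  · exact le_sup_left
  · exact le_sup_right

theorem inclEmb_inf {x : C.skeleton} (a b : C.data.block x) :
    C.inclEmb x (a ⊓ b) = C.inclEmb x a ⊓ C.inclEmb x b := by
  have h : C.inclEmb x (a ⊓ b) ≤ C.inclEmb x a ⊓ C.inclEmb x b :=
    le_inf ((C.inclEmb x).monotone inf_le_left) ((C.inclEmb x).monotone inf_le_right)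
  obtain ⟨c, hc⟩ := exists_inclEmb_eq h inf_le_left
  refine le_antisymm h ?_
  rw [← hc, OrderEmbedding.le_iff_le]
  refine le_inf ?_ ?_ <;> rw [← (C.inclEmb x).le_iff_le, hc]
  · exact inf_le_left
  · exact inf_le_right

/-- For `x ≤ y`, the blocks at `x` and `y` are glued exactly along the connection. -/
theorem inclEmb_eq_iff {x y : C.skeleton} (hxy : x ≤ y) {a : C.data.block x}
    {b : C.data.block y} : C.inclEmb x a = C.inclEmb y b ↔ C.Rel x y a b := by
  constructor
  · intro h
    obtain ⟨r, h₁, h₂⟩ := (toSum_eq_iff (p := ⟨x, a⟩) (q := ⟨y, b⟩)).1 h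
    obtain ⟨c, hc, hc'⟩ := C.overlap.interp h₁ y hxy (C.overlap.le h₂)
    obtain rfl : c = b := Rel.left_unique hc' h₂
    exact hc
  · exact fun h => (toSum_eq_iff (p := ⟨x, a⟩) (q := ⟨y, b⟩)).2 (.of_rel h)

variable (C)

/-- `p.1` is the lowest index over which the element of the sum given by `p` is represented. -/
def Lowest (p : C.Pairs) : Prop :=
  C.overlap.dual.Highest (OverlapSystem.toDualPair p)

theorem exists_lowest (p : C.Pairs) : ∃ q, C.overlap.Eqv p q ∧ C.Lowest q := by
  obtain ⟨q, h, h'⟩ := C.overlap.dual.exists_highest (OverlapSystem.toDualPair p)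
  exact ⟨⟨OrderDual.ofDual q.1, OrderDual.ofDual q.2⟩, .of_dual h, h'⟩

theorem lowest_top {x : C.skeleton} {a : C.data.block x} (ha : IsTop a) : C.Lowest ⟨x, a⟩ :=
  C.overlap.dual.highest_bot (x := OrderDual.toDual x) (a := OrderDual.toDual a) ha

theorem exists_highest_rep (s : C.Sum) : ∃ p, C.toSum p = s ∧ C.overlap.Highest p := by
  obtain ⟨p, rfl⟩ := C.toSum_surjective s
  obtain ⟨q, h, hq⟩ := C.overlap.exists_highest p
  exact ⟨q, toSum_eq_iff.2 h.symm, hq⟩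

theorem exists_lowest_rep (s : C.Sum) : ∃ p, C.toSum p = s ∧ C.Lowest p := by
  obtain ⟨p, rfl⟩ := C.toSum_surjective s
  obtain ⟨q, h, hq⟩ := C.exists_lowest p
  exact ⟨q, toSum_eq_iff.2 h.symm, hq⟩

variable {C}

/-- The highest block containing an element contains its upper covers. -/
theorem exists_of_highest_covBy {p : C.Pairs} (hp : C.overlap.Highest p) {s : C.Sum}
    (h : C.toSum p ⋖ s) : ∃ a, C.inclEmb p.1 a = s := by
  obtain ⟨q, rfl⟩ := C.toSum_surjective s
  rcases hp.exists_lt (toSum_le_iff.1 h.le) with e | ⟨a, ha, haq⟩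
  · exact (h.ne (toSum_eq_iff.2 e)).elim
  · refine ⟨a, (h.eq_or_eq ?_ (toSum_le_iff.2 haq)).resolve_left ?_⟩
    · exact (C.inclEmb p.1).monotone ha.le
    · exact fun e => ha.ne' ((C.inclEmb p.1).injective e)

theorem exists_of_covBy_lowest {p : C.Pairs} (hp : C.Lowest p) {s : C.Sum}
    (h : s ⋖ C.toSum p) : ∃ a, C.inclEmb p.1 a = s := by
  obtain ⟨q, rfl⟩ := C.toSum_surjective s
  rcases OverlapSystem.Highest.exists_lt hp (toSum_le_iff.1 h.le).dual with e | ⟨a, ha, haq⟩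
  · exact (h.ne' (toSum_eq_iff.2 (.of_dual e))).elim
  · have haq : C.overlap.Below q ⟨p.1, OrderDual.ofDual a⟩ := .of_dual haq
    have ha : OrderDual.ofDual a < p.2 := ha
    refine ⟨OrderDual.ofDual a, (h.eq_or_eq (toSum_le_iff.2 haq) ?_).resolve_right ?_⟩
    · exact (C.inclEmb p.1).monotone ha.le
    · exact fun e => ha.ne ((C.inclEmb p.1).injective e)

variable (C)

theorem isLFFC_sum : IsLFFC C.Sum where
  finite_interval p q := by
    obtain ⟨p, rfl⟩ := C.toSum_surjective p
    obtain ⟨q, rfl⟩ := C.toSum_surjective q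
    obtain ⟨F, hF, h⟩ := C.overlap.exists_finite_between p q
    refine (hF.image C.toSum).subset ?_
    rintro r ⟨h₁, h₂⟩
    obtain ⟨r, rfl⟩ := C.toSum_surjective r
    obtain ⟨r', hr', e⟩ := h r (toSum_le_iff.1 h₁) (toSum_le_iff.1 h₂)
    exact ⟨r', hr', (toSum_eq_iff.2 e).symm⟩
  finite_upper_covers s := by
    obtain ⟨p, rfl, hp⟩ := C.exists_highest_rep s
    have := C.isModularConnected.block_finite p.1
    exact (Set.finite_range (C.inclEmb p.1)).subset fun s hs => exists_of_highest_covBy hp hs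
  finite_lower_covers s := by
    obtain ⟨p, rfl, hp⟩ := C.exists_lowest_rep s
    have := C.isModularConnected.block_finite p.1
    exact (Set.finite_range (C.inclEmb p.1)).subset fun s hs => exists_of_covBy_lowest hp hs

theorem isModularLattice_sum : IsModularLattice C.Sum := by
  have : IsWeakUpperModularLattice C.Sum := by
    refine ⟨fun {s t} hs ht => ?_⟩
    obtain ⟨p, hp, hpmax⟩ := C.exists_highest_rep (s ⊓ t)
    obtain ⟨a, rfl⟩ := exists_of_highest_covBy hpmax (hp ▸ hs)
    obtain ⟨b, rfl⟩ := exists_of_highest_covBy hpmax (hp ▸ ht)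
    have := C.isModularConnected.block_modular p.1
    rw [← inclEmb_inf, inclEmb_covBy] at hs ht
    rw [← inclEmb_sup, inclEmb_covBy]
    exact covBy_sup_of_inf_covBy_of_inf_covBy_left hs ht
  have : IsWeakLowerModularLattice C.Sum := by
    refine ⟨fun {s t} hs ht => ?_⟩
    obtain ⟨p, hp, hpmin⟩ := C.exists_lowest_rep (s ⊔ t)
    obtain ⟨a, rfl⟩ := exists_of_covBy_lowest hpmin (hp ▸ hs)
    obtain ⟨b, rfl⟩ := exists_of_covBy_lowest hpmin (hp ▸ ht)
    have := C.isModularConnected.block_modular p.1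
    rw [← inclEmb_sup, inclEmb_covBy] at hs ht
    rw [← inclEmb_inf, inclEmb_covBy]
    exact inf_covBy_of_covBy_sup_of_covBy_sup_left hs ht
  exact isModularLattice_of_covering_conditions C.isLFFC_sum.finite_interval

theorem isSumLattice : C.IsSumLattice C.sumLattice :=
  ⟨fun _ _ => Iff.rfl, C.isModularLattice_sum, C.isLFFC_sum⟩

end MCSystem
end LatticeGluing

namespace LatticeGluing

/-! ### Functoriality of sums and dissections -/

namespace MCSystem.Iso

variable {C C' : MCSystem.{u}} (e : C.Iso C')

theorem rel_iff {x y : C.skeleton} {a : C.data.block x} {b : C.data.block y} :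
    C'.Rel (e.skel x) (e.skel y) (e.block x a) (e.block y b) ↔ C.Rel x y a b := by
  constructor
  · rintro ⟨h', ha', hb'⟩
    have h := e.leTol.2 h'
    have ha := ha'
    rw [e.source_eq x y h h'] at ha
    obtain ⟨a₁, ha, e₁⟩ := ha
    obtain rfl := (e.block x).injective e₁
    refine ⟨h, ha, (e.block y).injective ?_⟩
    rw [e.conn_eq x y h h' _ ha ha', hb']
  · rintro ⟨h, ha, rfl⟩
    have h' := e.leTol.1 h
    have ha' : e.block x a ∈ C'.data.source _ _ h' := by
      rw [e.source_eq x y h h']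
      exact ⟨a, ha, rfl⟩
    exact ⟨h', ha', (e.conn_eq x y h h' a ha ha').symm⟩

/-- The map on pairs induced by an isomorphism of systems. -/
def mapPair (p : C.Pairs) : C'.Pairs := ⟨e.skel p.1, e.block p.1 p.2⟩

theorem mapPair_surjective : Function.Surjective e.mapPair := by
  rintro ⟨x, a⟩
  obtain ⟨x, rfl⟩ := e.skel.surjective x
  obtain ⟨a, rfl⟩ := (e.block x).surjective a
  exact ⟨⟨x, a⟩, rfl⟩

theorem eqv_mapPair_iff {p q : C.Pairs} :
    C'.overlap.Eqv (e.mapPair p) (e.mapPair q) ↔ C.overlap.Eqv p q := by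
  constructor
  · rintro ⟨r, h₁, h₂⟩
    obtain ⟨r, rfl⟩ := e.mapPair_surjective r
    exact ⟨r, e.rel_iff.1 h₁, e.rel_iff.1 h₂⟩
  · rintro ⟨r, h₁, h₂⟩
    exact ⟨e.mapPair r, e.rel_iff.2 h₁, e.rel_iff.2 h₂⟩

/-- The map of sums induced by an isomorphism of systems. -/
def mapSum : C.Sum → C'.Sum :=
  Quot.map e.mapPair fun _ _ h => C'.sim_iff_eqv.2 (e.eqv_mapPair_iff.2 (C.sim_iff_eqv.1 h))

theorem mapSum_bijective : Function.Bijective e.mapSum := by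
  constructor
  · intro p q h
    obtain ⟨p, rfl⟩ := C.toSum_surjective p
    obtain ⟨q, rfl⟩ := C.toSum_surjective q
    exact toSum_eq_iff.2 (e.eqv_mapPair_iff.1 (toSum_eq_iff.1 h))
  · intro p
    obtain ⟨p, rfl⟩ := C'.toSum_surjective p
    obtain ⟨p, rfl⟩ := e.mapPair_surjective p
    exact ⟨C.toSum p, rfl⟩

theorem leAt_mapSum_iff {x : C.skeleton} {p q : C.Sum} :
    C'.LeAt (e.skel x) (e.mapSum p) (e.mapSum q) ↔ C.LeAt x p q := by
  constructor
  · rintro ⟨a, b, ha, hb, hab⟩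
    obtain ⟨a, rfl⟩ := (e.block x).surjective a
    obtain ⟨b, rfl⟩ := (e.block x).surjective b
    exact ⟨a, b, e.mapSum_bijective.1 ha, e.mapSum_bijective.1 hb, (e.block x).le_iff_le.1 hab⟩
  · rintro ⟨a, b, rfl, rfl, hab⟩
    exact ⟨e.block x a, e.block x b, rfl, rfl, (e.block x).monotone hab⟩

theorem sumLE_mapSum_iff {p q : C.Sum} :
    C'.SumLE (e.mapSum p) (e.mapSum q) ↔ C.SumLE p q := by
  constructor
  · rintro ⟨n, x, c, hx, hc, h₀, h₁⟩
    choose d hd using fun i => e.mapSum_bijective.2 (c i)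
    refine ⟨n, e.skel.symm ∘ x, d, e.skel.symm.monotone.comp hx, fun i => ?_,
      e.mapSum_bijective.1 ((hd 0).trans h₀), e.mapSum_bijective.1 ((hd _).trans h₁)⟩
    rw [← e.leAt_mapSum_iff, hd, hd, Function.comp_apply, OrderIso.apply_symm_apply]
    exact hc i
  · rintro ⟨n, x, c, hx, hc, rfl, rfl⟩
    exact ⟨n, e.skel ∘ x, e.mapSum ∘ c, e.skel.monotone.comp hx,
      fun i => e.leAt_mapSum_iff.2 (hc i), rfl, rfl⟩

/-- Isomorphic systems have isomorphic sums. -/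
noncomputable def sumIso : C.Sum ≃o C'.Sum where
  toEquiv := Equiv.ofBijective e.mapSum e.mapSum_bijective
  map_rel_iff' := e.sumLE_mapSum_iff

end MCSystem.Iso

section MapBlock

variable {L L' : Type u} [Lattice L] [Lattice L'] (e : L ≃o L')

/-- The image of a block under an isomorphism of lattices. -/
def Block.map (B : Block L) : Block L' where
  bot := e B.bot
  top := e B.top
  complemented := isComplementedLattice_Icc_iff.2 (B.complInterval.map e)
  maximal a b h hsub := by
    have hle := e.monotone B.bot_le_top
    have h := (isComplementedLattice_Icc_iff.1 h).map e.symm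
    obtain ⟨h₁, h₂⟩ := B.eq_of_le h (e.symm_apply_le.2 (hsub ⟨le_rfl, hle⟩).1)
      (e.le_symm_apply.2 (hsub ⟨hle, le_rfl⟩).2)
    rw [← h₁, ← h₂, e.apply_symm_apply, e.apply_symm_apply]

theorem Block.mem_map {B : Block L} {a : L} : e a ∈ (B.map e).set ↔ a ∈ B.set :=
  and_congr e.le_iff_le e.le_iff_le

/-- An isomorphism of lattices, restricted to a block. -/
def Block.restrictIso (B : Block L) : B.set ≃o (B.map e).set where
  toFun a := ⟨e a, (Block.mem_map e).2 a.2⟩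
  invFun a := ⟨e.symm a, (Block.mem_map e).1 (by rw [e.apply_symm_apply]; exact a.2)⟩
  left_inv a := by simp
  right_inv a := by simp
  map_rel_iff' := e.le_iff_le

end MapBlock

/-- Isomorphic modular l.f.f.c. lattices have isomorphic dissections. -/
noncomputable def ModularLFFCLattice.dissectIso {L L' : ModularLFFCLattice.{u}} (e : L ≃o L') :
    (L.dissect _ L.isDissectionSkeleton).Iso (L'.dissect _ L'.isDissectionSkeleton) where
  skel :=
    { toFun := Block.map e
      invFun := Block.map e.symm
      left_inv := fun B => Block.ext (e.symm_apply_apply _) (e.symm_apply_apply _)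
      right_inv := fun B => Block.ext (e.apply_symm_apply _) (e.apply_symm_apply _)
      map_rel_iff' := e.le_iff_le }
  block B := Block.restrictIso e B
  tol_iff B C := by
    refine Block.inter_nonempty_iff.trans (Iff.trans ?_ Block.inter_nonempty_iff.symm)
    exact (and_congr e.le_iff_le e.le_iff_le).symm
  source_eq B C _ _ := by
    ext a
    obtain ⟨a, rfl⟩ := (Block.restrictIso e B).surjective a
    refine Iff.trans ?_ (Block.restrictIso e B).injective.mem_set_image.symm
    exact Block.mem_map e
  target_eq B C _ _ := by
    ext a
    obtain ⟨a, rfl⟩ := (Block.restrictIso e C).surjective a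
    refine Iff.trans ?_ (Block.restrictIso e C).injective.mem_set_image.symm
    exact Block.mem_map e
  conn_eq _ _ _ _ _ _ _ := rfl

/-! ### Dissecting a sum -/

namespace MCSystem

variable {C : MCSystem.{u}}

theorem complInterval_inclEmb {x : C.skeleton} {a b : C.data.block x} (ha : IsBot a)
    (hb : IsTop b) : ComplInterval (C.inclEmb x a) (C.inclEmb x b) := by
  refine ⟨(C.inclEmb x).monotone (ha b), fun s h h' => ?_⟩
  obtain ⟨c, rfl⟩ := exists_inclEmb_eq h h'
  obtain ⟨_, _⟩ := C.isModularConnected.block_complemented x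
  obtain ⟨d, hd⟩ := exists_isCompl c
  refine ⟨C.inclEmb x d, ?_, ?_⟩
  · rw [← inclEmb_inf, hd.inf_eq_bot, ha.eq_bot]
  · rw [← inclEmb_sup, hd.sup_eq_top, hb.eq_top]

theorem upp_inclEmb_bot {x : C.skeleton} {a b : C.data.block x} (ha : IsBot a)
    (hb : IsTop b) : C.isLFFC_sum.upp (C.inclEmb x a) = C.inclEmb x b := by
  refine le_antisymm (C.isLFFC_sum.upp_le ((C.inclEmb x).monotone (ha b)) fun s hs => ?_)
    (C.isLFFC_sum.le_upp_of_complInterval (complInterval_inclEmb ha hb))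
  obtain ⟨c, rfl⟩ := exists_of_highest_covBy (C.overlap.highest_bot ha) hs
  exact (C.inclEmb x).monotone (hb c)

theorem low_inclEmb_top {x : C.skeleton} {a b : C.data.block x} (ha : IsBot a)
    (hb : IsTop b) : C.isLFFC_sum.low (C.inclEmb x b) = C.inclEmb x a := by
  have := C.isModularLattice_sum
  refine le_antisymm ((C.isLFFC_sum.gc _ _).2 (upp_inclEmb_bot ha hb).ge) ?_
  refine C.isLFFC_sum.dual.upp_le (a := OrderDual.toDual (C.inclEmb x b))
    (c := OrderDual.toDual (C.inclEmb x a)) ((C.inclEmb x).monotone (ha b)) fun s hs => ?_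
  obtain ⟨c, hc⟩ := exists_of_covBy_lowest (C.lowest_top hb) hs.ofDual
  have hs' : C.inclEmb x a ≤ OrderDual.ofDual s := hc ▸ (C.inclEmb x).monotone (ha c)
  exact hs'

variable (C)

/-- The bottom of a block of the system. -/
noncomputable def blockBot (x : C.skeleton) : C.data.block x := (C.overlap.exists_bot x).choose

/-- The top of a block of the system. -/
noncomputable def blockTop (x : C.skeleton) : C.data.block x := (C.overlap.exists_top x).choose

theorem isBot_blockBot (x : C.skeleton) : IsBot (C.blockBot x) :=
  (C.overlap.exists_bot x).choose_spec

theorem isTop_blockTop (x : C.skeleton) : IsTop (C.blockTop x) :=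
  (C.overlap.exists_top x).choose_spec

/-- The image of a block of the system is a block of the sum. -/
noncomputable def sumBlock (x : C.skeleton) : Block C.Sum :=
  have := C.isModularLattice_sum
  C.isLFFC_sum.mkBlock (C.inclEmb x (C.blockBot x)) (C.inclEmb x (C.blockTop x))
    (upp_inclEmb_bot (C.isBot_blockBot x) (C.isTop_blockTop x))
    (low_inclEmb_top (C.isBot_blockBot x) (C.isTop_blockTop x))

variable {C}

theorem mem_sumBlock {x : C.skeleton} {s : C.Sum} :
    s ∈ (C.sumBlock x).set ↔ ∃ a, C.inclEmb x a = s := by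
  constructor
  · rintro ⟨h, h'⟩
    exact exists_inclEmb_eq h h'
  · rintro ⟨a, rfl⟩
    exact ⟨(C.inclEmb x).monotone (C.isBot_blockBot x a),
      (C.inclEmb x).monotone (C.isTop_blockTop x a)⟩

theorem sumBlock_bot_le_iff {x y : C.skeleton} :
    (C.sumBlock x).bot ≤ (C.sumBlock y).bot ↔ x ≤ y :=
  toSum_le_iff.trans (C.overlap.below_bot_iff (C.isBot_blockBot x) (C.isBot_blockBot y))

/-- Every block of the sum comes from the system: it is contained in the highest block of the
system containing its bottom. -/
theorem sumBlock_surjective : Function.Surjective C.sumBlock := by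
  have := C.isModularLattice_sum
  intro B
  obtain ⟨p, hp, hmax⟩ := C.exists_highest_rep B.bot
  have hbot : (C.sumBlock p.1).bot ≤ B.bot := by
    rw [← hp]
    exact (C.inclEmb p.1).monotone (C.isBot_blockBot _ _)
  have htop : B.top ≤ (C.sumBlock p.1).top := by
    rw [← C.isLFFC_sum.upp_bot B, ← hp]
    refine C.isLFFC_sum.upp_le ((C.inclEmb p.1).monotone (C.isTop_blockTop _ _)) fun s hs => ?_
    obtain ⟨a, rfl⟩ := exists_of_highest_covBy hmax hs
    exact (C.inclEmb p.1).monotone (C.isTop_blockTop _ _)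
  obtain ⟨h₁, h₂⟩ := B.eq_of_le (C.sumBlock p.1).complInterval hbot htop
  exact ⟨p.1, Block.ext h₁ h₂⟩

theorem tol_iff_inter_sumBlock {x y : C.skeleton} :
    C.data.tol x y ↔ ((C.sumBlock x).set ∩ (C.sumBlock y).set).Nonempty := by
  constructor
  · intro h
    obtain ⟨-, -, -, -, hxy⟩ := LeTol.of_tol C.isModularConnected.tolerance h
    obtain ⟨a, c, hac⟩ := exists_rel_iff.2 hxy
    obtain ⟨b, hb, -⟩ := hac.interp inf_le_left (le_sup_left : x ≤ x ⊔ y)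
    obtain ⟨b', hb', -⟩ := hac.interp inf_le_right (le_sup_right : y ≤ x ⊔ y)
    refine ⟨C.inclEmb _ a, mem_sumBlock.2 ⟨b, ?_⟩, mem_sumBlock.2 ⟨b', ?_⟩⟩
    · exact ((inclEmb_eq_iff inf_le_left).2 hb).symm
    · exact ((inclEmb_eq_iff inf_le_right).2 hb').symm
  · rintro ⟨s, hx, hy⟩
    obtain ⟨a, rfl⟩ := mem_sumBlock.1 hx
    obtain ⟨b, hb⟩ := mem_sumBlock.1 hy
    have : C.Sim ⟨x, a⟩ ⟨y, b⟩ := C.sim_iff_eqv.2 (toSum_eq_iff.1 hb.symm)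
    exact this.1

/-- The isomorphism of a block of the system onto its image in the sum. -/
noncomputable def sumBlockIso (x : C.skeleton) : C.data.block x ≃o (C.sumBlock x).set :=
  RelIso.ofSurjective
    (OrderEmbedding.ofMapLEIff (fun a => ⟨C.inclEmb x a, mem_sumBlock.2 ⟨a, rfl⟩⟩)
      fun _ _ => (C.inclEmb x).le_iff_le)
    fun s => let ⟨a, ha⟩ := mem_sumBlock.1 s.2; ⟨a, Subtype.ext ha⟩

variable (C)

/-- An m.c. system is isomorphic to the dissection of its sum. -/
noncomputable def isoDissectGlue :
    C.Iso ((C.glue _ C.isSumLattice).dissect _ (C.glue _ C.isSumLattice).isDissectionSkeleton) where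
  skel := RelIso.ofSurjective
    (OrderEmbedding.ofMapLEIff (β := ((C.glue _ C.isSumLattice).dissect _
      (C.glue _ C.isSumLattice).isDissectionSkeleton).skeleton) C.sumBlock
      fun _ _ => sumBlock_bot_le_iff) sumBlock_surjective
  block x := sumBlockIso x
  tol_iff x y := tol_iff_inter_sumBlock
  source_eq x y h _ := by
    ext s
    obtain ⟨a, rfl⟩ := (sumBlockIso x).surjective s
    refine Iff.trans ?_ (Function.Injective.mem_set_image (OrderIso.injective _)).symm
    refine mem_sumBlock.trans ⟨?_, fun ha => ?_⟩
    · rintro ⟨b, hb⟩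
      exact ((inclEmb_eq_iff h.1).1 hb.symm).mem_source h
    · exact ⟨_, ((inclEmb_eq_iff h.1).2 (rel_of_mem_source ha)).symm⟩
  target_eq x y h _ := by
    ext s
    obtain ⟨b, rfl⟩ := (sumBlockIso y).surjective s
    refine Iff.trans ?_ (Function.Injective.mem_set_image (OrderIso.injective _)).symm
    refine mem_sumBlock.trans ⟨?_, fun hb => ?_⟩
    · rintro ⟨a, ha⟩
      exact ((inclEmb_eq_iff h.1).1 ha).mem_target h
    · obtain ⟨a, ha⟩ := rel_of_mem_target hb
      exact ⟨a, (inclEmb_eq_iff h.1).2 ha⟩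
  conn_eq x y h _ a ha _ :=
    Subtype.ext ((inclEmb_eq_iff h.1).2 (rel_of_mem_source ha)).symm

/-- The skeleton has a minimum iff the sum has one. For the converse, the element given by the
lowest representative of the minimum can be lowered inside its block unless its index is the
minimum of the skeleton. -/
theorem exists_isBot_skeleton_iff :
    (∃ m : C.skeleton, IsBot m) ↔ ∃ m : C.Sum, IsBot m := by
  constructor
  · rintro ⟨m, hm⟩
    refine ⟨C.inclEmb m (C.blockBot m), fun s => ?_⟩
    obtain ⟨⟨x, a⟩, rfl⟩ := C.toSum_surjective s
    exact (sumBlock_bot_le_iff.2 (hm x)).trans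
      ((C.inclEmb x).monotone (C.isBot_blockBot x a))
  · rintro ⟨s, hs⟩
    obtain ⟨p, rfl, hp⟩ := C.exists_lowest_rep s
    refine ⟨p.1, fun y => ?_⟩
    by_contra hy
    have hlt : p.1 ⊓ y < p.1 := lt_of_le_of_ne inf_le_left fun e => hy (inf_eq_left.1 e)
    obtain ⟨a, ha⟩ := OverlapSystem.Highest.exists_gt hp (z := OrderDual.toDual (p.1 ⊓ y)) hlt
    have ha : OrderDual.ofDual a < p.2 := ha
    exact ha.not_ge ((C.inclEmb p.1).le_iff_le.1 (hs (C.inclEmb p.1 (OrderDual.ofDual a))))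

end MCSystem

/-! ### Gluing a dissection -/

namespace ModularLFFCLattice

variable (L : ModularLFFCLattice.{u})

/-- The dissection of a modular l.f.f.c. lattice, with its lattice of blocks. -/
noncomputable abbrev dissection : MCSystem.{u} :=
  L.dissect L.skelLattice L.isDissectionSkeleton

variable {L}

theorem rel_dissection_iff {B C : Block L} {a : B.set} {b : C.set} :
    L.dissection.Rel B C a b ↔ B.bot ≤ C.bot ∧ a.1 = b.1 := by
  constructor
  · rintro ⟨h, _, rfl⟩
    exact ⟨h.1, rfl⟩
  · rintro ⟨h, e⟩
    have ha : a.1 ∈ C.set := e ▸ b.2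
    exact ⟨⟨h, a.1, a.2, ha⟩, ha, Subtype.ext e⟩

theorem le_of_path_dissection {p q : L.dissection.Pairs} (h : L.dissection.overlap.Path p q) :
    p.2.1 ≤ q.2.1 := by
  induction h with
  | refl => exact le_rfl
  | tail _ h ih =>
    cases h with
    | le h => exact ih.trans h
    | rel h => exact ih.trans (rel_dissection_iff.1 h).2.le

theorem path_dissection {B C : Block L} (h : B.bot ≤ C.bot) {b : L} (hb : b ∈ C.set) :
    ∀ ⦃a : L⦄ (ha : a ∈ B.set), a ≤ b →
      L.dissection.overlap.Path ⟨B, ⟨a, ha⟩⟩ ⟨C, ⟨b, hb⟩⟩ := by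
  let := L.modular
  let := L.skelLattice
  have h : B ≤ C := h
  refine covBy_induction L.lffc.isLFFC_block.finite_interval (y := C)
    (motive := fun B => ∀ ⦃a : L⦄ (ha : a ∈ B.set), a ≤ b →
      L.dissection.overlap.Path ⟨B, ⟨a, ha⟩⟩ ⟨C, ⟨b, hb⟩⟩) ?_ ?_ h
  · exact fun a ha hab => .of_le hab
  · intro B D hBD hDC ih a ha hab
    -- In the sum, the step from `B` to `D` is the join with the bottom of `D`.
    have hle : a ⊔ D.bot ≤ B.top := sup_le ha.2 (L.lffc.bot_le_top_of_covBy hBD)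
    have hB : a ⊔ D.bot ∈ B.set := ⟨ha.1.trans le_sup_left, hle⟩
    have hD : a ⊔ D.bot ∈ D.set := ⟨le_sup_right, hle.trans (L.lffc.bot_le_bot_iff.1 hBD.le)⟩
    have h₁ : L.dissection.overlap.Path ⟨B, ⟨a, ha⟩⟩ ⟨B, ⟨a ⊔ D.bot, hB⟩⟩ :=
      .of_le (le_sup_left : a ≤ a ⊔ D.bot)
    have h₂ : L.dissection.overlap.Path ⟨B, ⟨a ⊔ D.bot, hB⟩⟩ ⟨D, ⟨a ⊔ D.bot, hD⟩⟩ :=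
      .of_rel (rel_dissection_iff.2 ⟨hBD.le, rfl⟩)
    exact (h₁.trans h₂).trans (ih hD (sup_le hab (le_trans (α := L) hDC hb.1)))

theorem below_dissection_iff {p q : L.dissection.Pairs} :
    L.dissection.overlap.Below p q ↔ p.2.1 ≤ q.2.1 := by
  constructor
  · rintro ⟨r, hr, hqr⟩
    exact (le_of_path_dissection hr).trans (rel_dissection_iff.1 hqr).2.ge
  · intro h
    let := L.modular
    let := L.skelLattice
    obtain ⟨B, a⟩ := p
    obtain ⟨C, b⟩ := q
    have e : (B ⊔ C : Block L).bot = B.bot ⊔ C.bot := L.lffc.highBlock_bot_sup B C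
    have hb : b.1 ∈ (B ⊔ C : Block L).set :=
      ⟨e.le.trans (sup_le (a.2.1.trans h) b.2.1),
        b.2.2.trans (L.lffc.bot_le_bot_iff.1 (le_sup_right : C ≤ B ⊔ C))⟩
    exact ⟨⟨(B ⊔ C : Block L), ⟨b.1, hb⟩⟩, path_dissection (le_sup_left : B ≤ B ⊔ C) hb a.2 h,
      rel_dissection_iff.2 ⟨(le_sup_right : C ≤ B ⊔ C), rfl⟩⟩

variable (L)

/-- The map from the sum of the dissection to the lattice. -/
noncomputable def sumDissectionVal : L.dissection.Sum → L :=
  Quot.lift (fun p => p.2.1) fun _ _ h =>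
    have h := L.dissection.sim_iff_eqv.1 h
    le_antisymm (below_dissection_iff.1 h.below) (below_dissection_iff.1 h.symm.below)

/-- A modular l.f.f.c. lattice is isomorphic to the sum of its dissection. -/
noncomputable def glueDissectIso : L.dissection.Sum ≃o L :=
  RelIso.ofSurjective
    (OrderEmbedding.ofMapLEIff L.sumDissectionVal fun p q => by
      obtain ⟨p, rfl⟩ := L.dissection.toSum_surjective p
      obtain ⟨q, rfl⟩ := L.dissection.toSum_surjective q
      exact below_dissection_iff.symm.trans MCSystem.toSum_le_iff.symm)
    fun a =>
      have := L.modular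
      ⟨L.dissection.toSum ⟨L.lffc.highBlock a, ⟨a, L.lffc.mem_highBlock a⟩⟩, rfl⟩

theorem exists_isBot_dissection_iff :
    (∃ m : L.dissection.skeleton, IsBot m) ↔ ∃ m : L, IsBot m := by
  rw [MCSystem.exists_isBot_skeleton_iff]
  constructor
  · rintro ⟨m, hm⟩
    exact ⟨L.glueDissectIso m, fun a => L.glueDissectIso.le_symm_apply.1 (hm _)⟩
  · rintro ⟨m, hm⟩
    exact ⟨L.glueDissectIso.symm m, fun a => L.glueDissectIso.symm_apply_le.2 (hm _)⟩

end ModularLFFCLattice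

end LatticeGluing

theorem mainTheorem1 :
    (∀ C : MCSystem.{u}, Equivalence C.Sim) ∧
    ∃ (sumLat : ∀ C : MCSystem.{u}, Lattice C.Sum)
      (hsum : ∀ C : MCSystem.{u}, C.IsSumLattice (sumLat C))
      (skelLat : ∀ L : ModularLFFCLattice.{u}, Lattice (Block L))
      (hskel : ∀ L : ModularLFFCLattice.{u}, IsDissectionSkeleton L (skelLat L))
      (glue_iso : ∀ C C' : MCSystem.{u}, C ≈ C' →
        C.glue (sumLat C) (hsum C) ≈ C'.glue (sumLat C') (hsum C'))
      (dissect_iso : ∀ L L' : ModularLFFCLattice.{u}, L ≈ L' →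
        L.dissect (skelLat L) (hskel L) ≈ L'.dissect (skelLat L') (hskel L')),
      Function.LeftInverse (dissectClass skelLat hskel dissect_iso)
        (glueClass sumLat hsum glue_iso) ∧
      Function.RightInverse (dissectClass skelLat hskel dissect_iso)
        (glueClass sumLat hsum glue_iso) ∧
      Function.Bijective (glueClass sumLat hsum glue_iso) ∧
      Function.Bijective (dissectClass skelLat hskel dissect_iso) ∧
      (∀ C : MCSystem.{u}, (∃ m : C.skeleton, IsBot m) ↔
        ∃ m : C.glue (sumLat C) (hsum C), IsBot m) ∧
      (∀ L : ModularLFFCLattice.{u},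
        (∃ m : (L.dissect (skelLat L) (hskel L)).skeleton, IsBot m) ↔ ∃ m : L, IsBot m) := by
  refine ⟨MCSystem.equivalence_sim, MCSystem.sumLattice, MCSystem.isSumLattice,
    ModularLFFCLattice.skelLattice, ModularLFFCLattice.isDissectionSkeleton,
    fun C C' ⟨e⟩ => ⟨e.sumIso⟩, fun L L' ⟨e⟩ => ⟨ModularLFFCLattice.dissectIso e⟩, ?_⟩
  have left : Function.LeftInverse
      (dissectClass ModularLFFCLattice.skelLattice ModularLFFCLattice.isDissectionSkeleton
        fun L L' ⟨e⟩ => ⟨ModularLFFCLattice.dissectIso e⟩)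
      (glueClass MCSystem.sumLattice MCSystem.isSumLattice fun C C' ⟨e⟩ => ⟨e.sumIso⟩) := by
    intro c
    induction c using Quotient.inductionOn with
    | h C => exact Quotient.sound ⟨C.isoDissectGlue.symm⟩
  have right : Function.RightInverse
      (dissectClass ModularLFFCLattice.skelLattice ModularLFFCLattice.isDissectionSkeleton
        fun L L' ⟨e⟩ => ⟨ModularLFFCLattice.dissectIso e⟩)
      (glueClass MCSystem.sumLattice MCSystem.isSumLattice fun C C' ⟨e⟩ => ⟨e.sumIso⟩) := by
    intro l
    induction l using Quotient.inductionOn with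
    | h L => exact Quotient.sound ⟨L.glueDissectIso⟩
  exact ⟨left, right, ⟨left.injective, right.surjective⟩, ⟨right.injective, left.surjective⟩,
    MCSystem.exists_isBot_skeleton_iff, ModularLFFCLattice.exists_isBot_dissection_iff⟩
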